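/- Model. A distributed state machine $\mathcal A$ over finite sets $I$ of local inputs and $O$ of local outputs consists of a set $S\supseteq O$ of states, a finite set $H\subseteq S$ of halting states, a set $M$ of messages, and functions $\sigma_0\colon\mathbb N\times I\to S$, $\mu\colon S\to M$ and $\sigma\colon S\times\mathcal P(M)\to S$ with $\sigma(h,\mathcal M)=h$ for all $h\in H$, $\mathcal M\subseteq M$. On a finite, simple, connected, undirected graph $G=(V,E)$ with input $f\colon V\to I$ its execution is $x_0(v)=\sigma_0(\deg v,f(v))$, $x_{r+1}(v)=\sigma\bigl(x_r(v),\{\mu(x_r(u)):u\in N(v)\}\bigr)$. The running time on $(G,f)$ is the smallest $t$ with $x_t(v)\in H$ for all $v\in V$ (it is $\infty$ if there is none), the output is then $x_t$, and the space usage is $\lceil\log_2|\{x_r(v):r\in\mathbb N,\,v\in V\}|\rceil$. In time (space) $T\colon\mathbb N\to\mathbb N$ means that the running time (space usage) is at most $T(|V|)$ on all instances $(G,f)$ under consideration. Problem. The valid words over $\{0,1,\_\}$ are $\_0\_$ and everything obtained from it by repeatedly applying the substitution $0\mapsto 0\_1\_1\_0$, $1\mapsto 1\_0\_0\_1$, $\_\mapsto\_$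 to all letters simultaneously (these are the Thue–Morse words $T_{2i}$ of length $4^i$, $i\ge 0$, with a separator $\_$ at the beginning, between consecutive symbols and at the end). In the decision problem $\mathsf{ThueMorse}$ the local inputs are in $\{\alpha,\beta,\gamma\}\times\{0,1,\_\}$ and the local outputs in $\{\mathsf{yes},\mathsf{no}\}$. An instance $(G,f)$ with $f=(f_1,f_2)$ is a yes-instance if and only if $G$ is a path $v_1v_2\dots v_n$, numbered in one of its two directions, such that $f_1(v_{k+1})$ is the cyclic successor of $f_1(v_k)$ in $\alpha\to\beta\to\gamma\to\alpha$ for all $1\le k<n$, and $f_2(v_1)f_2(v_2)\dots f_2(v_n)$ is a valid word. In a yes-instance every node has to output $\mathsf{yes}$, and in a no-instance every node has to output $\mathsf{no}$. Theorem. In the class of graphs of maximum degree at most $2$, the decision problem $\mathsf{ThueMorse}$ has constant space complexity and time complexity $\Theta(n)$, where $n$ is the number of nodes. More precisely: (1) There is a distributed state machine that halts with the correct output on every finite connected graph (of any maximum degree) and every input, in time $T(n)=\Theta(n)$ and in space $O(1)$. (2) There are $c>0$ and $n_0$ such that every distributed state machine (of any space usage) that solves $\mathsf{ThueMorse}$ in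 time $T$ on all connected graphs of maximum degree at most $2$ satisfies $T(n)\ge cn$ for all $n\ge n_0$. -/

import Mathlib

namespace SetBroadcast

/-- A distributed state machine of the anonymous set-broadcast model, for local inputs in `I` and
local outputs in `O`. The local output of a node is the halting state that it has reached; the
embedding `answer` says which state is the output `o : O`. -/
structure Machine (I O : Type) where
  /-- states -/
  State : Type
  /-- messages -/
  Msg : Type
  /-- the finite set of halting states -/
  halting : Set State
  halting_finite : halting.Finite
  /-- the initial state, a function of the degree and of the local input -/
  init : ℕ → I → State
  /-- the message that is broadcast to all neighbours -/
  send : State → Msg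
  /-- the new state, a function of the old state and of the set of received messages -/
  step : State → Set Msg → State
  step_halting : ∀ h ∈ halting, ∀ A : Set Msg, step h A = h
  answer : O ↪ State

/-- A graph problem maps each graph with local inputs to a set of valid solutions. -/
def GraphProblem (I O : Type) : Type 1 :=
  ∀ ⦃V : Type⦄, SimpleGraph V → (V → I) → Set (V → O)

/-- A class of graphs. -/
def GraphClass : Type 1 := ∀ ⦃V : Type⦄, SimpleGraph V → Prop

/-- The class of all graphs. -/
def allGraphs : GraphClass := fun _ _ => True

/-- The class of graphs of maximum degree at most `d`. -/
def maxDegreeAtMost (d : ℕ) : GraphClass := fun _ G => ∀ v, (G.neighborSet v).ncard ≤ d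

namespace Machine

variable {I O : Type}

/-- `A.exec G f r v` is the state of the node `v` in round `r`. -/
noncomputable def exec (A : Machine I O) {V : Type} (G : SimpleGraph V) (f : V → I) : ℕ → V → A.State
  | 0 => fun v => A.init (G.neighborSet v).ncard (f v)
  | r + 1 => fun v =>
      A.step (A.exec G f r v) ((fun u => A.send (A.exec G f r u)) '' G.neighborSet v)

/-- The execution halts and its running time is `t`: the smallest round in which all the nodes
are in a halting state. -/
def HasRunningTime (A : Machine I O) {V : Type} (G : SimpleGraph V) (f : V → I) (t : ℕ) : Prop :=
  IsLeast {r : ℕ | ∀ v, A.exec G f r v ∈ A.halting} t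

/-- The set of all the states that are visited in at least one node during the execution. -/
def visited (A : Machine I O) {V : Type} (G : SimpleGraph V) (f : V → I) : Set A.State :=
  {s | ∃ (r : ℕ) (v : V), s = A.exec G f r v}

/-- `A` solves the problem `P` in time `T` on the (finite, connected) graphs of the class `C`:
the execution halts within `T n` rounds, where `n` is the number of nodes, and the output is a
valid solution. -/
def SolvesInTime (A : Machine I O) (P : GraphProblem I O) (C : GraphClass) (T : ℕ → ℕ) : Prop :=
  ∀ (V : Type) [Finite V] (G : SimpleGraph V), G.Connected → C G → ∀ f : V → I,
    ∃ t : ℕ, A.HasRunningTime G f t ∧ t ≤ T (Nat.card V) ∧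
      ∃ s ∈ P G f, ∀ v, A.exec G f t v = A.answer (s v)

/-- On the (finite, connected) graphs of the class `C` the space usage of `A`, that is, the number
`⌈log₂ k⌉` of bits needed to encode the `k` visited states, is at most `U n`, where `n` is the
number of nodes. -/
def UsesSpace (A : Machine I O) (C : GraphClass) (U : ℕ → ℕ) : Prop :=
  ∀ (V : Type) [Finite V] (G : SimpleGraph V), G.Connected → C G → ∀ f : V → I,
    (A.visited G f).Finite ∧ Nat.clog 2 (A.visited G f).ncard ≤ U (Nat.card V)

end Machine

/-- The local outputs of a decision problem. -/
inductive Answer : Type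
  | yes
  | no

/-- The decision graph problem with given yes-instances: all the nodes answer `yes` in a
yes-instance, and all the nodes answer `no` in a no-instance. -/
def decisionProblem {I : Type} (yesInstance : ∀ ⦃V : Type⦄, SimpleGraph V → (V → I) → Prop) :
    GraphProblem I Answer :=
  fun _ G f => {s | (yesInstance G f → ∀ v, s v = Answer.yes) ∧
    (¬ yesInstance G f → ∀ v, s v = Answer.no)}

/-- The orientation labels. -/
inductive Label : Type
  | alpha
  | beta
  | gamma

/-- The cyclic successor `α ↦ β ↦ γ ↦ α`. -/
def Label.next : Label → Label
  | .alpha => .beta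
  | .beta => .gamma
  | .gamma => .alpha

/-- The word symbols `0`, `1` and the separator `_`. -/
inductive Letter : Type
  | zero
  | one
  | sep

/-- The substitution `0 ↦ 0_1_1_0`, `1 ↦ 1_0_0_1`, which keeps separators. -/
def Letter.subst : Letter → List Letter
  | .zero => [.zero, .sep, .one, .sep, .one, .sep, .zero]
  | .one => [.one, .sep, .zero, .sep, .zero, .sep, .one]
  | .sep => [.sep]

/-- Valid words: `_0_` is valid, and applying the substitution to every letter of a valid word
gives a valid word. -/
inductive ValidWord : List Letter → Prop
  | base : ValidWord [.sep, .zero, .sep]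
  | step {w : List Letter} : ValidWord w → ValidWord (w.flatMap Letter.subst)

/-- Yes-instances of the problem ThueMorse. The graph is a path, with nodes
`e 0, e 1, …, e (n - 1)` in this order, such that the orientation labels go cyclically through
`α, β, γ` along the path, and the symbols read along the path form a valid word. (Valid words are
palindromes, so the direction of reading does not matter.) -/
def IsThueMorseYes ⦃V : Type⦄ (G : SimpleGraph V) (f : V → Label × Letter) : Prop :=
  ∃ (n : ℕ) (e : SimpleGraph.pathGraph n ≃g G),
    (∀ i j : Fin n, (j : ℕ) = i + 1 → (f (e j)).1 = (f (e i)).1.next) ∧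
    ValidWord (List.ofFn fun i : Fin n => (f (e i)).2)

/-- The decision graph problem ThueMorse. -/
def ThueMorse : GraphProblem (Label × Letter) Answer := decisionProblem IsThueMorseYes

end SetBroadcast

/-! Upper bound. The substitution can be undone locally: cut the bits into blocks `x x̄ x̄ x` and
keep the first bit of each. At level `k` the surviving bits are held by active nodes at mutual
distance `2 * 4 ^ k`, and all other nodes relay signals. A phase consists of seven traversals of
this distance, in which each active node learns the seven nearest bits on either side. A bit that
does not lie in exactly one recognized block rejects; otherwise it stays active iff it starts its
block. A lone survivor rejects if its bit is one and otherwise triggers acceptance. No node stores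
`k` or a distance, because the arrival of signals serves as the clock; so finitely many states
suffice. The phases last `14 * 4 ^ k` rounds, a geometric sum, and `2 * 4 ^ k ≤ n`, so the time is
linear.

The pattern `x x̄ x̄ x` also occurs across two equal adjacent blocks, at offset two. A start is
therefore recognized only at the left end or directly after another block. A false start would then
need three equal consecutive Thue–Morse terms, which `thueMorse_no_cube` excludes
(`IsThueMorsePrefix.isStart_iff`). Conversely, if each bit is covered exactly once, then the starts
form a residue class modulo four (`exists_isStart_iff`), so the next level exists
(`IsLevel.exists_succ`).

The labels tell left from right, so a connected graph in which no node rejects in round one is a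
path or a cycle. Both are handled as a track indexed by the integers, a cycle being unrolled
periodically. Even on a cycle a block at level `k` consists of `2 * 4 ^ k` distinct nodes
(`IsLevel.spacing_le_card`), so the levels cannot go on forever.

After a rejection, distant nodes continue with meaningless data. They must not accept, so acceptance
needs a wave of marks that crosses the graph from left to right. A node that has rejected before the
wave starts blocks it (`never_yes`), and the rejection then spreads to all nodes.

Lower bound. The left end of a path that is faulty only at its far end cannot distinguish it, within
fewer rounds than its length, from the beginning of a long valid path. -/

namespace SetBroadcast

/-! ### The Thue–Morse sequence and the valid words -/

/-- The Thue–Morse sequence: the parity of the number of binary digits `1`. -/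
def thueMorse (n : ℕ) : Bool :=
  if h : n = 0 then false else xor (thueMorse (n / 2)) (decide (n % 2 = 1))
decreasing_by omega

theorem thueMorse_zero : thueMorse 0 = false := by
  rw [thueMorse]; simp

theorem thueMorse_two_mul (n : ℕ) : thueMorse (2 * n) = thueMorse n := by
  rcases Nat.eq_zero_or_pos n with rfl | h
  · rfl
  · conv_lhs => rw [thueMorse]
    have h1 : 2 * n / 2 = n := by omega
    have h2 : ¬ (2 * n % 2 = 1) := by omega
    simp [h1, h.ne']

theorem thueMorse_two_mul_add_one (n : ℕ) : thueMorse (2 * n + 1) = !thueMorse n := by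
  conv_lhs => rw [thueMorse]
  have h1 : (2 * n + 1) / 2 = n := by omega
  simp [h1]

theorem thueMorse_four_mul (n : ℕ) : thueMorse (4 * n) = thueMorse n := by
  rw [show 4 * n = 2 * (2 * n) by ring, thueMorse_two_mul, thueMorse_two_mul]

theorem thueMorse_four_mul_add_one (n : ℕ) : thueMorse (4 * n + 1) = !thueMorse n := by
  rw [show 4 * n + 1 = 2 * (2 * n) + 1 by ring, thueMorse_two_mul_add_one, thueMorse_two_mul]

theorem thueMorse_four_mul_add_two (n : ℕ) : thueMorse (4 * n + 2) = !thueMorse n := by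
  rw [show 4 * n + 2 = 2 * (2 * n + 1) by ring, thueMorse_two_mul, thueMorse_two_mul_add_one]

theorem thueMorse_four_mul_add_three (n : ℕ) : thueMorse (4 * n + 3) = thueMorse n := by
  rw [show 4 * n + 3 = 2 * (2 * n + 1) + 1 by ring, thueMorse_two_mul_add_one,
    thueMorse_two_mul_add_one, Bool.not_not]

theorem thueMorse_four_mul_add (n r : ℕ) (hr : r < 4) :
    thueMorse (4 * n + r) = xor (thueMorse n) (thueMorse r) := by
  have h0 := thueMorse_zero
  have h1 := thueMorse_four_mul_add_one 0
  have h2 := thueMorse_four_mul_add_two 0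
  have h3 := thueMorse_four_mul_add_three 0
  interval_cases r
  · simp [thueMorse_four_mul, h0]
  · simp [thueMorse_four_mul_add_one] at h1 ⊢; simp [h1, h0]
  · simp [thueMorse_four_mul_add_two] at h2 ⊢; simp [h2, h0]
  · simp [thueMorse_four_mul_add_three] at h3 ⊢; simp [h3, h0]

/-- The binary digits of `4 ^ k * r` and `s` do not overlap, so the parities add. This is the
`k`-fold substitution read letter by letter: it says which letters a surviving bit stands for. -/
theorem thueMorse_pow_mul_add (k r s : ℕ) (hs : s < 4 ^ k) :
    thueMorse (4 ^ k * r + s) = xor (thueMorse r) (thueMorse s) := by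
  induction k generalizing s with
  | zero => obtain rfl : s = 0 := by simpa using hs
            simp [thueMorse_zero]
  | succ k ih =>
    have h4 : s / 4 < 4 ^ k := by rw [pow_succ] at hs; omega
    have e1 : 4 ^ (k + 1) * r + s = 4 * (4 ^ k * r + s / 4) + s % 4 := by
      rw [pow_succ]
      have := Nat.div_add_mod s 4
      nlinarith
    have e2 : s = 4 * (s / 4) + s % 4 := (Nat.div_add_mod s 4).symm
    rw [e1, thueMorse_four_mul_add _ _ (Nat.mod_lt _ (by norm_num)), ih _ h4]
    conv_rhs => rw [e2, thueMorse_four_mul_add _ _ (Nat.mod_lt _ (by norm_num))]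
    rw [Bool.xor_assoc]

/-- The Thue–Morse sequence has no three equal consecutive terms. -/
theorem thueMorse_no_cube (n : ℕ) (h₁ : thueMorse n = thueMorse (n + 1))
    (h₂ : thueMorse (n + 1) = thueMorse (n + 2)) : False := by
  -- The terms `2 * m` and `2 * m + 1` differ, and among three consecutive indices there is such a
  -- pair.
  rcases Nat.even_or_odd' n with ⟨m, rfl | rfl⟩
  · rw [thueMorse_two_mul, thueMorse_two_mul_add_one] at h₁
    simp at h₁
  · rw [show 2 * m + 1 + 1 = 2 * (m + 1) by ring, show 2 * m + 1 + 2 = 2 * (m + 1) + 1 by ring,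
      thueMorse_two_mul, thueMorse_two_mul_add_one] at h₂
    simp at h₂

/-- The letter that stands for a bit. -/
def Letter.ofBool : Bool → Letter
  | false => .zero
  | true => .one

/-- The letters of the infinite separated Thue–Morse word. -/
def thueMorseLetter (i : ℕ) : Letter :=
  if i % 2 = 1 then Letter.ofBool (thueMorse (i / 2)) else .sep

theorem thueMorseLetter_odd (i : ℕ) :
    thueMorseLetter (2 * i + 1) = Letter.ofBool (thueMorse i) := by
  have h1 : (2 * i + 1) % 2 = 1 := by omega
  have h2 : (2 * i + 1) / 2 = i := by omega
  simp [thueMorseLetter, h1, h2]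

theorem thueMorseLetter_even (i : ℕ) : thueMorseLetter (2 * i) = .sep := by
  simp [thueMorseLetter]

theorem map_thueMorseLetter_range (m : ℕ) :
    (List.range (2 * m + 1)).map thueMorseLetter =
      .sep :: (List.range m).flatMap fun i => [Letter.ofBool (thueMorse i), .sep] := by
  induction m with
  | zero => simpa using thueMorseLetter_even 0
  | succ m ih =>
    rw [show 2 * (m + 1) + 1 = 2 * m + 1 + 1 + 1 by ring, List.range_succ, List.range_succ,
      List.map_append, List.map_append, ih, List.range_succ, List.flatMap_append]
    simp only [List.map_cons, List.map_nil, thueMorseLetter_odd, List.flatMap_cons,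
      List.flatMap_nil]
    rw [show 2 * m + 1 + 1 = 2 * (m + 1) by ring, thueMorseLetter_even]
    simp

/-- The leading separator is fixed, and each bit with the separator after it turns into four bits
with theirs. -/
theorem flatMap_subst_map_thueMorseLetter (m : ℕ) :
    ((List.range (2 * m + 1)).map thueMorseLetter).flatMap Letter.subst =
      (List.range (2 * (4 * m) + 1)).map thueMorseLetter := by
  rw [map_thueMorseLetter_range, map_thueMorseLetter_range, List.flatMap_cons]
  simp only [Letter.subst, List.cons_append, List.nil_append, List.cons.injEq, true_and]
  induction m with
  | zero => simp
  | succ m ih =>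
    rw [show 4 * (m + 1) = 4 * m + 1 + 1 + 1 + 1 by ring, List.range_succ (n := m),
      List.range_succ, List.range_succ, List.range_succ, List.range_succ]
    simp only [List.flatMap_append, ih, List.flatMap_cons, List.flatMap_nil, List.append_nil,
      List.append_assoc, List.append_cancel_left_eq,
      thueMorse_four_mul, thueMorse_four_mul_add_one, thueMorse_four_mul_add_two,
      thueMorse_four_mul_add_three]
    cases thueMorse m <;> simp [Letter.ofBool, Letter.subst]

theorem validWord_iff (w : List Letter) :
    ValidWord w ↔ ∃ k : ℕ, w = (List.range (2 * 4 ^ k + 1)).map thueMorseLetter := by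
  constructor
  · intro h
    induction h with
    | base =>
      refine ⟨0, ?_⟩
      rw [map_thueMorseLetter_range]
      simp [thueMorse_zero, Letter.ofBool]
    | step _ ih =>
      obtain ⟨k, rfl⟩ := ih
      exact ⟨k + 1, by rw [flatMap_subst_map_thueMorseLetter, pow_succ, mul_comm 4]⟩
  · rintro ⟨k, rfl⟩
    induction k with
    | zero =>
      have := ValidWord.base
      rw [map_thueMorseLetter_range]
      simpa [thueMorse_zero, Letter.ofBool] using this
    | succ k ih =>
      rw [pow_succ, mul_comm _ 4, ← flatMap_subst_map_thueMorseLetter]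
      exact ih.step

theorem validWord_ofFn_iff (n : ℕ) (g : Fin n → Letter) :
    ValidWord (List.ofFn g) ↔
      ∃ k : ℕ, n = 2 * 4 ^ k + 1 ∧ ∀ i : Fin n, g i = thueMorseLetter i := by
  rw [validWord_iff]
  refine exists_congr fun k => ⟨fun h => ?_, ?_⟩
  · have hn : n = 2 * 4 ^ k + 1 := by simpa using congrArg List.length h
    refine ⟨hn, fun i => ?_⟩
    have hi : (i : ℕ) < 2 * 4 ^ k + 1 := i.2.trans_eq hn
    have := congrArg (fun l => l[(i : ℕ)]?) h
    simpa [hi] using this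
  · rintro ⟨rfl, h⟩
    rw [show g = fun i : Fin _ => thueMorseLetter i from funext h]
    refine List.ext_getElem (by simp) fun i h₁ h₂ => ?_
    rw [List.getElem_ofFn, List.getElem_map, List.getElem_range]

/-! ### The linear lower bound -/

theorem Label.next_ne (l : Label) : l.next ≠ l := by
  cases l <;> simp [Label.next]

/-- The labels `α, β, γ, α, β, γ, …`. -/
def cyclicLabel : ℕ → Label
  | 0 => .alpha
  | n + 1 => (cyclicLabel n).next

/-- The yes-instance on a path. -/
def prefixInput (n : ℕ) (i : Fin n) : Label × Letter := (cyclicLabel i, thueMorseLetter i)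

/-- The no-instance on a path that differs from `prefixInput` in the label of the last node. -/
def brokenInput (n : ℕ) (i : Fin n) : Label × Letter :=
  (if (i : ℕ) + 1 = n then cyclicLabel (n - 2) else cyclicLabel i, thueMorseLetter i)

theorem isThueMorseYes_prefixInput (k : ℕ) :
    IsThueMorseYes (SimpleGraph.pathGraph (2 * 4 ^ k + 1)) (prefixInput (2 * 4 ^ k + 1)) := by
  refine ⟨_, RelIso.refl _, fun i j h => ?_, ?_⟩
  · simp [prefixInput, h, cyclicLabel]
  · exact (validWord_ofFn_iff _ _).2 ⟨k, rfl, fun i => rfl⟩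

/-- The last two nodes are adjacent and share a label, whereas in a yes-instance one of two adjacent
labels is the successor of the other, whichever way the path is read. -/
theorem not_isThueMorseYes_brokenInput (n : ℕ) :
    ¬ IsThueMorseYes (SimpleGraph.pathGraph (n + 2)) (brokenInput (n + 2)) := by
  rintro ⟨m, e, hl, -⟩
  let u : Fin (n + 2) := ⟨n, by omega⟩
  let w : Fin (n + 2) := ⟨n + 1, by omega⟩
  have hu : (brokenInput (n + 2) u).1 = cyclicLabel n := by simp [brokenInput, u]
  have hw : (brokenInput (n + 2) w).1 = cyclicLabel n := by simp [brokenInput, w]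
  have hadj : (SimpleGraph.pathGraph (n + 2)).Adj u w := by
    simp [SimpleGraph.pathGraph_adj, u, w]
  have h2 : (SimpleGraph.pathGraph m).Adj (e.symm u) (e.symm w) := e.symm.map_adj_iff.2 hadj
  rw [SimpleGraph.pathGraph_adj] at h2
  rcases h2 with h2 | h2
  · have := hl _ _ h2.symm
    rw [e.apply_symm_apply, e.apply_symm_apply, hu, hw] at this
    exact Label.next_ne _ this.symm
  · have := hl _ _ h2.symm
    rw [e.apply_symm_apply, e.apply_symm_apply, hu, hw] at this
    exact Label.next_ne _ this.symm

theorem image_castLE_neighborSet_pathGraph {n N : ℕ} (h : n ≤ N) (i : Fin n) (hi : (i : ℕ) + 1 < n) :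
    Fin.castLE h '' (SimpleGraph.pathGraph n).neighborSet i =
      (SimpleGraph.pathGraph N).neighborSet (Fin.castLE h i) := by
  ext j
  simp only [Set.mem_image, SimpleGraph.mem_neighborSet, SimpleGraph.pathGraph_adj]
  constructor
  · rintro ⟨a, ha, rfl⟩
    simpa using ha
  · intro hj
    have hj' : (j : ℕ) < n := by
      simp only [Fin.val_castLE] at hj
      omega
    exact ⟨⟨j, hj'⟩, by simpa using hj, by ext; simp⟩

/-- Information moves one edge per round, and the two instances differ only from the last node of
the short path on, in label or degree. The hypothesis keeps that node out of the ball of radius `r`.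
-/
theorem exec_brokenInput {O : Type} (A : Machine (Label × Letter) O) {n N : ℕ} (h : n ≤ N) (r : ℕ)
    (i : Fin n) (hi : (i : ℕ) + r + 1 < n) :
    A.exec (SimpleGraph.pathGraph n) (brokenInput n) r i =
      A.exec (SimpleGraph.pathGraph N) (prefixInput N) r (Fin.castLE h i) := by
  induction r generalizing i with
  | zero =>
    simp only [Machine.exec]
    rw [← image_castLE_neighborSet_pathGraph h i (by omega),
      Set.ncard_image_of_injective _ (Fin.castLE_injective h)]
    have : (i : ℕ) + 1 ≠ n := by omega
    simp [brokenInput, prefixInput, this]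
  | succ r ih =>
    simp only [Machine.exec]
    rw [← image_castLE_neighborSet_pathGraph h i (by omega), Set.image_image, ih i (by omega)]
    congr 1
    refine Set.image_congr fun j hj => ?_
    rw [SimpleGraph.mem_neighborSet, SimpleGraph.pathGraph_adj] at hj
    rw [ih j (by omega)]

theorem maxDegreeAtMost_two_pathGraph (n : ℕ) : maxDegreeAtMost 2 (SimpleGraph.pathGraph n) := by
  intro i
  have hinj : Set.InjOn (fun j : Fin n => (j : ℕ)) ((SimpleGraph.pathGraph n).neighborSet i) :=
    fun a _ b _ hab => Fin.ext hab
  rw [← hinj.ncard_image]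
  have hsub : (fun j : Fin n => (j : ℕ)) '' (SimpleGraph.pathGraph n).neighborSet i ⊆
      ({(i : ℕ) - 1, (i : ℕ) + 1} : Finset ℕ) := by
    rintro _ ⟨j, hj, rfl⟩
    rw [SimpleGraph.mem_neighborSet, SimpleGraph.pathGraph_adj] at hj
    simp only [Finset.coe_insert, Finset.coe_singleton, Set.mem_insert_iff,
      Set.mem_singleton_iff]
    omega
  refine (Set.ncard_le_ncard hsub (Finset.finite_toSet _)).trans ?_
  rw [Set.ncard_coe_finset]
  exact Finset.card_le_two

theorem Machine.exec_of_halting {I O V : Type} (A : Machine I O) (G : SimpleGraph V) (f : V → I)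
    {r s : ℕ} (hrs : r ≤ s) {v : V} (h : A.exec G f r v ∈ A.halting) :
    A.exec G f s v = A.exec G f r v := by
  induction s, hrs using Nat.le_induction with
  | base => rfl
  | succ s _ ih => simp only [Machine.exec]; rw [ih, A.step_halting _ h]

/-- The left end answers no on the broken path before it can tell it from a long valid one. Halting
states are permanent, so it gives the same, wrong, answer there. -/
theorem linear_lower_bound (A : Machine (Label × Letter) Answer) (T : ℕ → ℕ)
    (hA : A.SolvesInTime ThueMorse (maxDegreeAtMost 2) T) (n : ℕ) : n ≤ T (n + 2) := by
  by_contra! hlt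
  -- Any valid word that is at least as long as the short path would do.
  have hN : n + 2 ≤ 2 * 4 ^ (n + 2) + 1 := by
    have := (Nat.lt_pow_self (n := n + 2) (a := 4) (by norm_num)).le
    omega
  obtain ⟨t, ht, htT, s, hs, hout⟩ := hA _ (SimpleGraph.pathGraph (n + 2))
    (SimpleGraph.pathGraph_connected (n + 1)) (maxDegreeAtMost_two_pathGraph _) (brokenInput (n + 2))
  obtain ⟨t', ht', -, s', hs', hout'⟩ := hA _ (SimpleGraph.pathGraph (2 * 4 ^ (n + 2) + 1))
    (SimpleGraph.pathGraph_connected _) (maxDegreeAtMost_two_pathGraph _) (prefixInput _)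
  rw [Nat.card_fin] at htT
  let z : Fin (n + 2) := ⟨0, by omega⟩
  have hno : s z = .no := hs.2 (not_isThueMorseYes_brokenInput n) z
  have hyes : s' (Fin.castLE hN z) = .yes := hs'.1 (isThueMorseYes_prefixInput _) _
  have e1 := exec_brokenInput A hN t z (by simp [z]; omega)
  have h1 := ht.1 z
  have h2 := ht'.1 (Fin.castLE hN z)
  -- The long run may halt globally at another time, so the states are compared at the later of the
  -- two.
  have e2 := A.exec_of_halting _ _ (le_max_left t t') (e1 ▸ h1)
  have e3 := A.exec_of_halting _ _ (le_max_right t t') h2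
  rw [e2, ← e1, hout, hout', hno, hyes] at e3
  simpa using A.answer.injective e3

/-! ### The machine -/

/-- The label that precedes a label cyclically. -/
def Label.prev (l : Label) : Label := l.next.next

theorem Label.prev_ne_next (l : Label) : l.prev ≠ l.next := by
  cases l <;> simp [Label.next, Label.prev]

theorem Label.eq_prev_iff {l m : Label} : m = l.prev ↔ l = m.next := by
  cases l <;> cases m <;> simp [Label.next, Label.prev]

/-- The bit of a word symbol, and `none` for a separator. -/
def Letter.bit : Letter → Option Bool
  | .zero => some false
  | .one => some true
  | .sep => none

/-- The dynamic part of the state of a running node. A signal is an optional symbol, where the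
symbol `none` stands for a place beyond the end of the path. -/
inductive Cell : Type
  /-- a node before the first round, which knows whether it has degree one -/
  | raw (isEnd : Bool) (symbol : Option Bool)
  /-- an inactive node, with a signal that moves to the right and one that moves to the left -/
  | relay (toRight toLeft : Option (Option Bool))
  /-- an active node that holds a bit and knows the symbols of the nearest active nodes -/
  | active (bit : Bool) (count : Fin 7) (left right : Fin 7 → Option Bool)
      (toRight toLeft : Option (Option Bool))
  /-- the only node that is still active, with the bit zero -/
  | finish
  /-- a node that has been visited by the final wave from left to right -/
  | mark

/-- The result of one step of a running node. -/
inductive Verdict : Type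
  | accept
  | reject
  | continue (c : Cell)

/-- The signal that moves to the right. -/
def Cell.toRight : Cell → Option (Option Bool)
  | .relay r _ => r
  | .active _ _ _ _ r _ => r
  | _ => none

/-- The signal that moves to the left. -/
def Cell.toLeft : Cell → Option (Option Bool)
  | .relay _ l => l
  | .active _ _ _ _ _ l => l
  | _ => none

/-- The word `w` has the block `x x̄ x̄ x` at position `i`. -/
def IsBlock (w : ℤ → Option Bool) (i : ℤ) : Prop :=
  ∃ x, w i = some x ∧ w (i + 1) = some !x ∧ w (i + 2) = some !x ∧ w (i + 3) = some x

/-- The position `i` is recognized as the start of a block of the word `w`. -/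
def IsStart (w : ℤ → Option Bool) (i : ℤ) : Prop :=
  -- The pattern alone is ambiguous: it also occurs at offset two when two adjacent blocks are
  -- equal.
  IsBlock w i ∧ (w (i - 1) = none ∨ IsBlock w (i - 4))

/-- The position `i` belongs to exactly one recognized block of the word `w`. -/
def IsCovered (w : ℤ → Option Bool) (i : ℤ) : Prop :=
  ∃! r : Fin 4, IsStart w (i - (r : ℕ))

/-- The state of a node that becomes active, where `first` and `last` tell whether there is no
active node to its left and to its right. -/
def spawn (x first last : Bool) : Verdict :=
  -- A lone survivor is the fully desubstituted word, which must be the single bit zero.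
  if first && last then (if x then .reject else .continue .finish)
  else .continue (.active x 0 (fun _ => none) (fun _ => none) (some (some x)) (some (some x)))

/-- The word around an active node that holds the bit `x`, as far as it is known. -/
def localWord (x : Bool) (left right : Fin 7 → Option Bool) (i : ℤ) : Option Bool :=
  if i = 0 then some x
  else if h : 0 < i ∧ i ≤ 7 then right ⟨(i - 1).toNat, by omega⟩
  else if h : i < 0 ∧ -7 ≤ i then left ⟨(-i - 1).toNat, by omega⟩
  else none

open Classical in
/-- The decision of an active node that knows its surroundings. -/
noncomputable def decideBlock (x : Bool) (w : ℤ → Option Bool) : Verdict :=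
  if IsCovered w 0 then
    if IsStart w 0 then spawn x (w (-1)).isNone (w 4).isNone
    else .continue (.relay none none)
  else .reject

/-- The rule of an active node. -/
noncomputable def activeRule (l : Option Cell) (x : Bool) (n : Fin 7) (left right : Fin 7 → Option Bool)
    (r : Option Cell) : Verdict :=
  let fromLeft := l.bind Cell.toRight
  let fromRight := r.bind Cell.toLeft
  -- Active nodes are equally spaced, so signals from both sides arrive in the same round. If only
  -- one arrives, there is no active node on the other side, and `join` records `none` there.
  if fromLeft = none ∧ fromRight = none then .continue (.active x n left right none none)
  else
    let left' := Function.update left n fromLeft.join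
    let right' := Function.update right n fromRight.join
    if n = 6 then decideBlock x (localWord x left' right')
    -- Each symbol is forwarded in its direction of travel, so the next traversal brings symbols
    -- from one active node further away.
    else .continue (.active x (n + 1) left' right' (some fromLeft.join) (some fromRight.join))

open Classical in
/-- The rule of an inactive node. -/
noncomputable def relayRule (l r : Option Cell) : Verdict :=
  if l = some .mark then (if r = none then .accept else .continue .mark)
  -- The last active node is the right neighbour of the left end, which starts the wave.
  else if l = none ∧ r = some .finish then .continue .mark
  else .continue (.relay (l.bind Cell.toRight) (r.bind Cell.toLeft))

open Classical in
/-- The rule of a running node, given the cells of its left and right neighbours. -/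
noncomputable def cellRule : Option Cell → Cell → Option Cell → Verdict
  -- Symbols and separators must alternate, and only a separator of degree one may lack a neighbour.
  | some (.raw _ (some _)), .raw _ none, some (.raw _ (some _)) => .continue (.relay none none)
  | none, .raw true none, some (.raw _ (some _)) => .continue (.relay none none)
  | some (.raw _ (some _)), .raw true none, none => .continue (.relay none none)
  | some (.raw e₁ none), .raw _ (some x), some (.raw e₂ none) => spawn x e₁ e₂
  | _, .raw _ _, _ => .reject
  | l, .relay _ _, r => relayRule l r
  | l, .active x n left right _ _, r => activeRule l x n left right r
  | l, .finish, r =>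
    if l = some .mark then (if r = none then .accept else .continue .mark) else .continue .finish
  | l, .mark, r => if l = some .mark ∧ r = none then .accept else .continue .mark

/-- The states of the machine. -/
inductive NodeState : Type
  | yes
  | no
  | run (l : Label) (c : Cell)

/-- The state of a node with label `l` after a step. -/
def Verdict.toState (l : Label) : Verdict → NodeState
  | .accept => .yes
  | .reject => .no
  | .continue c => .run l c

open Classical in
/-- The cell of a neighbour with label `l`, if there is one. -/
noncomputable def pick (A : Set NodeState) (l : Label) : Option Cell :=
  -- The choice is harmless: in an oriented neighbourhood each label belongs to at most one
  -- neighbour.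
  if h : ∃ c, NodeState.run l c ∈ A then some h.choose else none

open Classical in
/-- The initial state. -/
noncomputable def initialState (d : ℕ) (i : Label × Letter) : NodeState :=
  if d = 1 ∧ i.2 = .sep then .run i.1 (.raw true none)
  else if d = 2 then .run i.1 (.raw false i.2.bit)
  else .no

open Classical in
/-- The transition function. -/
noncomputable def transition : NodeState → Set NodeState → NodeState
  | .yes, _ => .yes
  | .no, _ => .no
  | .run l c, A =>
    if .no ∈ A then .no
    else if .yes ∈ A then .yes
    else (cellRule (pick A l.prev) c (pick A l.next)).toState l

/-- The machine that solves the problem `ThueMorse`. -/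
noncomputable def thueMorseMachine : Machine (Label × Letter) Answer where
  State := NodeState
  Msg := NodeState
  halting := {.yes, .no}
  halting_finite := by simp
  init := initialState
  send := id
  step := transition
  step_halting := by
    rintro h (rfl | rfl) A <;> rfl
  answer :=
    { toFun := fun | .yes => .yes | .no => .no
      inj' := by
        intro a b h
        cases a <;> cases b <;> simp_all }

/-! ### Constant space -/

theorem finite_cell : Finite Cell := by
  let B := Option Bool
  let S := Option (Option Bool)
  let φ : Cell → (Bool × B) ⊕ (S × S) ⊕ (Bool × Fin 7 × (Fin 7 → B) × (Fin 7 → B) × S × S) ⊕ Bool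
    | .raw e s => .inl (e, s)
    | .relay r l => .inr (.inl (r, l))
    | .active x n L R r l => .inr (.inr (.inl (x, n, L, R, r, l)))
    | .finish => .inr (.inr (.inr false))
    | .mark => .inr (.inr (.inr true))
  refine Finite.of_injective φ fun a b h => ?_
  cases a <;> cases b <;> simp_all [φ]

theorem finite_label : Finite Label := by
  let φ : Label → Fin 3
    | .alpha => 0
    | .beta => 1
    | .gamma => 2
  refine Finite.of_injective φ fun a b h => ?_
  cases a <;> cases b <;> simp_all [φ]

theorem finite_nodeState : Finite NodeState := by
  have := finite_cell
  have := finite_label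
  let φ : NodeState → Bool ⊕ (Label × Cell)
    | .yes => .inl true
    | .no => .inl false
    | .run l c => .inr (l, c)
  refine Finite.of_injective φ fun a b h => ?_
  cases a <;> cases b <;> simp_all [φ]

theorem exists_usesSpace_thueMorseMachine :
    ∃ c : ℕ, thueMorseMachine.UsesSpace allGraphs fun _ => c := by
  have : Finite thueMorseMachine.State := finite_nodeState
  refine ⟨Nat.clog 2 (Nat.card thueMorseMachine.State), fun V _ G _ _ f => ⟨Set.toFinite _, ?_⟩⟩
  exact Nat.clog_mono_right _ (Set.ncard_le_card _)

/-! ### Runs on arbitrary graphs: halting and orientation -/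

section Graph

variable {V : Type} (G : SimpleGraph V) (f : V → Label × Letter)

/-- The execution of `thueMorseMachine`. -/
noncomputable abbrev run (t : ℕ) (v : V) : NodeState := thueMorseMachine.exec G f t v

/-- The states of the neighbours. -/
noncomputable abbrev received (t : ℕ) (v : V) : Set NodeState := run G f t '' G.neighborSet v

variable {G f}

theorem run_zero (v : V) : run G f 0 v = initialState (G.neighborSet v).ncard (f v) := rfl

theorem run_succ (t : ℕ) (v : V) :
    run G f (t + 1) v = transition (run G f t v) (received G f t v) := rfl

theorem run_eq_yes_of_le {s t : ℕ} (hst : s ≤ t) {v : V} (h : run G f s v = .yes) :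
    run G f t v = .yes := by
  induction t, hst using Nat.le_induction with
  | base => exact h
  | succ t _ ih => rw [run_succ, ih]; rfl

theorem run_eq_no_of_le {s t : ℕ} (hst : s ≤ t) {v : V} (h : run G f s v = .no) :
    run G f t v = .no := by
  induction t, hst using Nat.le_induction with
  | base => exact h
  | succ t _ ih => rw [run_succ, ih]; rfl

theorem run_label {t : ℕ} {v : V} {l : Label} {c : Cell} (h : run G f t v = .run l c) :
    l = (f v).1 := by
  induction t generalizing l c with
  | zero =>
    rw [run_zero, initialState] at h
    split_ifs at h <;> simp_all
  | succ t ih =>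
    rw [run_succ] at h
    rcases hs : run G f t v with _ | _ | ⟨l', c'⟩
    · simp [hs, transition] at h
    · simp [hs, transition] at h
    · rw [hs, transition] at h
      split_ifs at h
      rw [← ih hs]
      rcases hr : cellRule (pick (received G f t v) l'.prev) c' (pick (received G f t v) l'.next)
        with _ | _ | c'' <;> simp_all [Verdict.toState]

theorem exists_run_of_ne {t : ℕ} {v : V} (h : run G f t v ≠ .no) (h' : run G f t v ≠ .yes) :
    ∃ c, run G f t v = .run (f v).1 c := by
  rcases hs : run G f t v with _ | _ | ⟨l, c⟩
  · exact absurd hs h'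
  · exact absurd hs h
  · exact ⟨c, by rw [run_label hs]⟩

/-- The cell of a node with no halted neighbour in the next round. -/
theorem run_succ_of_run {t : ℕ} {v : V} {c : Cell} (h : run G f t v = .run (f v).1 c)
    (hno : ∀ w, G.Adj v w → run G f t w ≠ .no) (hyes : ∀ w, G.Adj v w → run G f t w ≠ .yes) :
    run G f (t + 1) v = (cellRule (pick (received G f t v) (f v).1.prev) c
      (pick (received G f t v) (f v).1.next)).toState (f v).1 := by
  rw [run_succ, h, transition, if_neg, if_neg]
  · rintro ⟨w, hw, h⟩; exact hyes w hw h
  · rintro ⟨w, hw, h⟩; exact hno w hw h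

theorem run_succ_of_no {t : ℕ} {v w : V} (hvw : G.Adj v w) (h : run G f t w = .no)
    (hv : run G f t v ≠ .yes) : run G f (t + 1) v = .no := by
  rcases hs : run G f t v with _ | _ | ⟨l, c⟩
  · exact absurd hs hv
  · exact run_eq_no_of_le t.le_succ hs
  · rw [run_succ, hs, transition, if_pos ⟨w, hvw, h⟩]

theorem run_succ_of_yes {t : ℕ} {v w : V} (hvw : G.Adj v w) (h : run G f t w = .yes)
    (hv : run G f (t + 1) v ≠ .no) : run G f (t + 1) v = .yes := by
  rcases hs : run G f t v with _ | _ | ⟨l, c⟩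
  · exact run_eq_yes_of_le t.le_succ hs
  · exact absurd (run_eq_no_of_le t.le_succ hs) hv
  · rw [run_succ, hs, transition] at hv ⊢
    split_ifs at hv ⊢ with h1 h2
    · exact absurd rfl hv
    · rfl
    · exact absurd ⟨w, hvw, h⟩ h2

theorem pick_eq_none_iff {A : Set NodeState} {l : Label} :
    pick A l = none ↔ ∀ c, NodeState.run l c ∉ A := by
  simp [pick]

theorem mem_of_pick_eq_some {A : Set NodeState} {l : Label} {c : Cell} (h : pick A l = some c) :
    NodeState.run l c ∈ A := by
  rw [pick] at h
  split_ifs at h with h'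
  obtain rfl : h'.choose = c := by simpa using h
  exact h'.choose_spec

theorem exists_adj_of_pick_eq_some {t : ℕ} {v : V} {l : Label} {c : Cell}
    (h : pick (received G f t v) l = some c) :
    ∃ w, G.Adj v w ∧ (f w).1 = l ∧ run G f t w = .run l c := by
  obtain ⟨w, hw, hc⟩ := mem_of_pick_eq_some h
  exact ⟨w, hw, (run_label hc).symm, hc⟩

/-- The two neighbours of a node have the labels that precede and follow its own label. -/
structure IsOriented (G : SimpleGraph V) (f : V → Label × Letter) (v : V) : Prop where
  label_eq : ∀ w, G.Adj v w → (f w).1 = (f v).1.next ∨ (f w).1 = (f v).1.prev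
  eq_of_label_eq : ∀ w w', G.Adj v w → G.Adj v w' → (f w).1 = (f w').1 → w = w'

theorem IsOriented.pick_eq_some {v w : V} (hv : IsOriented G f v) (hvw : G.Adj v w) {t : ℕ}
    {c : Cell} (hc : run G f t w = .run (f w).1 c) :
    pick (received G f t v) (f w).1 = some c := by
  rcases hp : pick (received G f t v) (f w).1 with _ | c'
  · rw [pick_eq_none_iff] at hp
    exact absurd ⟨w, hvw, hc⟩ (hp c)
  · obtain ⟨w', hw', hl, hc'⟩ := exists_adj_of_pick_eq_some hp
    obtain rfl := hv.eq_of_label_eq _ _ hw' hvw hl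
    rw [hc] at hc'
    simp_all

theorem ncard_neighborSet_of_run_zero {v : V} {l : Label} {e : Bool} {x : Option Bool}
    (h : run G f 0 v = .run l (.raw e x)) :
    (G.neighborSet v).ncard = if e then 1 else 2 := by
  rw [run_zero, initialState] at h
  split_ifs at h with h1 h2 <;> simp_all

/-- A set of messages does not reveal the number of neighbours, but the initial state records the
degree. A node of degree two survives only if it hears both the preceding and the following label,
so each belongs to exactly one neighbour; with degree one, hearing either label suffices. -/
theorem isOriented_of_run_one {v : V} (h : run G f 1 v ≠ .no) :
    IsOriented G f v := by
  have h0 : run G f 0 v ≠ .no := fun h0 => h (run_eq_no_of_le zero_le_one h0)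
  have h0y : ∀ w, run G f 0 w ≠ .yes := by
    intro w
    rw [run_zero, initialState]
    split_ifs <;> simp
  have hraw : ∃ e x, run G f 0 v = .run (f v).1 (.raw e x) := by
    rw [run_zero, initialState] at h0 ⊢
    split_ifs at h0 ⊢ <;> simp_all
  obtain ⟨e, x, hex⟩ := hraw
  have hcard := ncard_neighborSet_of_run_zero hex
  have h1 := run_succ_of_run hex
    (fun w hw hw0 => h (run_succ_of_no hw hw0 (h0y v))) (fun w _ => h0y w)
  have hrule : cellRule (pick (received G f 0 v) (f v).1.prev) (.raw e x)
      (pick (received G f 0 v) (f v).1.next) ≠ .reject := by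
    intro hr
    rw [hr] at h1
    exact h h1
  rcases hl : pick (received G f 0 v) (f v).1.prev with _ | cl
  · rcases hr : pick (received G f 0 v) (f v).1.next with _ | cr
    · rw [hl, hr] at hrule
      cases e <;> cases x <;> simp [cellRule] at hrule
    · obtain ⟨w, hw, hwl, -⟩ := exists_adj_of_pick_eq_some hr
      have he : e = true := by
        rw [hl, hr] at hrule
        by_contra he
        cases e <;> cases x <;> simp [cellRule] at hrule he
      rw [he, if_pos rfl, Set.ncard_eq_one] at hcard
      obtain ⟨z, hz⟩ := hcard
      have hzw : ∀ w, G.Adj v w ↔ w = z := fun w => by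
        rw [← SimpleGraph.mem_neighborSet, hz, Set.mem_singleton_iff]
      simp only [hzw] at hw
      subst hw
      constructor
      · intro w' hw'; left; rw [(hzw _).1 hw', hwl]
      · intro a b ha hb _; rw [(hzw _).1 ha, (hzw _).1 hb]
  · obtain ⟨w, hw, hwl, -⟩ := exists_adj_of_pick_eq_some hl
    rcases hr : pick (received G f 0 v) (f v).1.next with _ | cr
    · have he : e = true := by
        rw [hl, hr] at hrule
        by_contra he
        cases e <;> cases x <;> simp [cellRule] at hrule he
      rw [he, if_pos rfl, Set.ncard_eq_one] at hcard
      obtain ⟨z, hz⟩ := hcard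
      have hzw : ∀ w, G.Adj v w ↔ w = z := fun w => by
        rw [← SimpleGraph.mem_neighborSet, hz, Set.mem_singleton_iff]
      simp only [hzw] at hw
      subst hw
      constructor
      · intro w' hw'; right; rw [(hzw _).1 hw', hwl]
      · intro a b ha hb _; rw [(hzw _).1 ha, (hzw _).1 hb]
    · obtain ⟨w', hw', hwl', -⟩ := exists_adj_of_pick_eq_some hr
      have hne : w ≠ w' := by
        rintro rfl
        exact Label.prev_ne_next _ (hwl.symm.trans hwl')
      have hfin : (G.neighborSet v).Finite := by
        apply Set.finite_of_ncard_ne_zero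
        rw [hcard]; split_ifs <;> simp
      have hsub : ({w, w'} : Set V) ⊆ G.neighborSet v := by
        rintro _ (rfl | rfl)
        · exact hw
        · exact hw'
      have hle : (G.neighborSet v).ncard ≤ ({w, w'} : Set V).ncard := by
        rw [Set.ncard_pair hne, hcard]; split_ifs <;> simp
      have heq := Set.eq_of_subset_of_ncard_le hsub hle hfin
      have hzw : ∀ z, G.Adj v z ↔ z = w ∨ z = w' := fun z => by
        rw [← SimpleGraph.mem_neighborSet, ← heq, Set.mem_insert_iff, Set.mem_singleton_iff]
      constructor
      · intro z hz
        rcases (hzw _).1 hz with rfl | rfl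
        · exact Or.inr hwl
        · exact Or.inl hwl'
      · intro a b ha hb hab
        rcases (hzw _).1 ha with rfl | rfl <;> rcases (hzw _).1 hb with rfl | rfl
        · rfl
        · exact absurd (hwl.symm.trans (hab.trans hwl')) (Label.prev_ne_next _)
        · exact absurd (hwl.symm.trans (hab.symm.trans hwl')) (Label.prev_ne_next _)
        · rfl

/-- A rejection advances one edge per round unless it meets an acceptance, and a path in the graph
has fewer edges than there are nodes. -/
theorem eventually_all_no [Finite V] (hG : G.Connected) {t : ℕ} {u : V} (hu : run G f t u = .no)
    (hyes : ∀ s, t ≤ s → ∀ v, run G f s v ≠ .yes) (v : V) :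
    run G f (t + Nat.card V) v = .no := by
  have key : ∀ (a b : V) (p : G.Walk a b), run G f t a = .no →
      run G f (t + p.length) b = .no := by
    intro a b p ha
    induction p using SimpleGraph.Walk.concatRec with
    | Hnil => exact ha
    | Hconcat p h ih =>
      rw [SimpleGraph.Walk.length_concat, ← add_assoc]
      exact run_succ_of_no h.symm (ih ha) (hyes _ (Nat.le_add_right _ _) _)
  obtain ⟨p, hp⟩ := (hG u v).exists_isPath
  have := Fintype.ofFinite V
  have hlt := hp.length_lt
  rw [← Nat.card_eq_fintype_card] at hlt
  exact run_eq_no_of_le (by omega) (key u v p hu)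

theorem eventually_all_yes [Finite V] (hG : G.Connected) {t : ℕ} {u : V} (hu : run G f t u = .yes)
    (hno : ∀ s, t ≤ s → ∀ v, run G f s v ≠ .no) (v : V) :
    run G f (t + Nat.card V) v = .yes := by
  have key : ∀ (a b : V) (p : G.Walk a b), run G f t a = .yes →
      run G f (t + p.length) b = .yes := by
    intro a b p ha
    induction p using SimpleGraph.Walk.concatRec with
    | Hnil => exact ha
    | Hconcat p h ih =>
      rw [SimpleGraph.Walk.length_concat, ← add_assoc]
      exact run_succ_of_yes h.symm (ih ha) (hno _ (by omega) _)
  obtain ⟨p, hp⟩ := (hG u v).exists_isPath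
  have := Fintype.ofFinite V
  have hlt := hp.length_lt
  rw [← Nat.card_eq_fintype_card] at hlt
  exact run_eq_yes_of_le (by omega) (key u v p hu)

end Graph

/-! ### No acceptance after an early rejection -/

theorem spawn_ne_accept (x first last : Bool) : spawn x first last ≠ .accept := by
  cases x <;> cases first <;> cases last <;> simp [spawn]

theorem spawn_ne_mark (x first last : Bool) : spawn x first last ≠ .continue .mark := by
  cases x <;> cases first <;> cases last <;> simp [spawn]

theorem decideBlock_ne_accept (x : Bool) (w : ℤ → Option Bool) : decideBlock x w ≠ .accept := by
  rw [decideBlock]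
  split_ifs
  · exact spawn_ne_accept _ _ _
  · simp
  · simp

theorem decideBlock_ne_mark (x : Bool) (w : ℤ → Option Bool) :
    decideBlock x w ≠ .continue .mark := by
  rw [decideBlock]
  split_ifs
  · exact spawn_ne_mark _ _ _
  · simp
  · simp

theorem activeRule_ne_accept (l x n L R r) : activeRule l x n L R r ≠ .accept := by
  simp only [activeRule]
  split_ifs
  · simp
  · exact decideBlock_ne_accept _ _
  · simp

theorem activeRule_ne_mark (l x n L R r) : activeRule l x n L R r ≠ .continue .mark := by
  simp only [activeRule]
  split_ifs
  · simp
  · exact decideBlock_ne_mark _ _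
  · simp

theorem cellRule_active (l : Option Cell) (x n L R s s') (r : Option Cell) :
    cellRule l (.active x n L R s s') r = activeRule l x n L R r := by
  rw [cellRule]

theorem cellRule_relay (l : Option Cell) (s s') (r : Option Cell) :
    cellRule l (.relay s s') r = relayRule l r := by
  rw [cellRule]

open Classical in
theorem cellRule_finish (l r : Option Cell) :
    cellRule l .finish r =
      if l = some .mark then (if r = none then .accept else .continue .mark)
      else .continue .finish := by
  rw [cellRule]

open Classical in
theorem cellRule_mark (l r : Option Cell) : cellRule l .mark r =
    if l = some .mark ∧ r = none then .accept else .continue .mark := by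
  rw [cellRule]

theorem cellRule_eq_accept {l r : Option Cell} {c : Cell} (h : cellRule l c r = .accept) :
    l = some .mark ∧ r = none := by
  rcases c with ⟨e, s⟩ | ⟨s, s'⟩ | ⟨x, n, L, R, s, s'⟩ | _ | _
  · rw [cellRule.eq_def] at h
    split at h <;> simp_all [spawn_ne_accept]
  · rw [cellRule_relay, relayRule] at h
    split_ifs at h
    exact ⟨‹_›, ‹_›⟩
  · rw [cellRule_active] at h
    exact absurd h (activeRule_ne_accept _ _ _ _ _ _)
  · rw [cellRule_finish] at h
    split_ifs at h
    exact ⟨‹_›, ‹_›⟩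
  · rw [cellRule_mark] at h
    split_ifs at h with h1
    exact h1

/-- Lets a mark be traced back in time: unless it was already there, it came from the left or arose
at a node without a left neighbour. -/
theorem cellRule_eq_mark {l r : Option Cell} {c : Cell} (h : cellRule l c r = .continue .mark) :
    c = .mark ∨ l = some .mark ∨ l = none := by
  rcases c with ⟨e, s⟩ | ⟨s, s'⟩ | ⟨x, n, L, R, s, s'⟩ | _ | _
  · rw [cellRule.eq_def] at h
    split at h <;> simp_all [spawn_ne_mark]
  · rw [cellRule_relay, relayRule] at h
    split_ifs at h with h1 h2 h3
    · exact Or.inr (Or.inl h1)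
    · exact Or.inr (Or.inr h3.1)
    · simp at h
  · rw [cellRule_active] at h
    exact absurd h (activeRule_ne_mark _ _ _ _ _ _)
  · rw [cellRule_finish] at h
    split_ifs at h with h1 h2
    · exact Or.inr (Or.inl h1)
    · simp at h
  · exact Or.inl rfl

section Graph

variable {V : Type} {G : SimpleGraph V} {f : V → Label × Letter}

theorem exists_cell_of_run_succ {t : ℕ} {v : V} (h : run G f (t + 1) v ≠ .no)
    (h' : run G f t v ≠ .yes) (hyes : ∀ w, G.Adj v w → run G f t w ≠ .yes) :
    (∀ w, G.Adj v w → run G f t w ≠ .no) ∧ ∃ c, run G f t v = .run (f v).1 c ∧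
      run G f (t + 1) v = (cellRule (pick (received G f t v) (f v).1.prev) c
        (pick (received G f t v) (f v).1.next)).toState (f v).1 := by
  have hno : ∀ w, G.Adj v w → run G f t w ≠ .no := fun w hw hw' => h (run_succ_of_no hw hw' h')
  obtain ⟨c, hc⟩ := exists_run_of_ne (fun hv => h (run_eq_no_of_le t.le_succ hv)) h'
  exact ⟨hno, c, hc, run_succ_of_run hc hno hyes⟩

/-- If some node rejects before the final wave has started, then no node accepts: the final wave
would have to visit all the nodes. -/
theorem never_yes (hG : G.Connected) {t₀ : ℕ} (ht₀ : 1 ≤ t₀) {u : V} (hu : run G f t₀ u = .no)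
    (hyes : ∀ v, run G f t₀ v ≠ .yes) (hmark : ∀ v, run G f t₀ v ≠ .run (f v).1 .mark)
    (t : ℕ) (ht : t₀ ≤ t) (v : V) : run G f t v ≠ .yes := by
  induction t, ht using Nat.le_induction generalizing v with
  | base => exact hyes v
  | succ t₁ ht₁ ih =>
  intro he
  have hbefore : ∀ s, t₀ ≤ s → s ≤ t₁ → ∀ v, run G f s v ≠ .yes :=
    fun s _ hs v hv => ih v (run_eq_yes_of_le hs hv)
  have horient : ∀ s, t₀ ≤ s → ∀ v, run G f s v ≠ .no → IsOriented G f v := fun s hs v hv =>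
    isOriented_of_run_one fun h1 => hv (run_eq_no_of_le (ht₀.trans hs) h1)
  -- By induction on time: when a node with a left neighbour is first marked, that neighbour already
  -- carries a mark.
  have hmarked : ∀ s, t₀ ≤ s → s ≤ t₁ → ∀ v, run G f s v = .run (f v).1 .mark →
      ∀ w, G.Adj v w → (f w).1 = (f v).1.prev →
        ∃ s, t₀ ≤ s ∧ s ≤ t₁ ∧ run G f s w = .run (f w).1 .mark := by
    intro s hs
    induction s, hs using Nat.le_induction with
    | base => exact fun _ v hv => absurd hv (hmark v)
    | succ s hs ihs =>
      intro hs₁ v hv w hvw hw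
      obtain ⟨hno, c, hc, hstep⟩ := exists_cell_of_run_succ (by rw [hv]; simp)
        (hbefore s hs (by omega) v) (fun w _ => hbefore s hs (by omega) w)
      rw [hv] at hstep
      have hrule : cellRule (pick (received G f s v) (f v).1.prev) c
          (pick (received G f s v) (f v).1.next) = .continue .mark := by
        rcases hr : cellRule (pick (received G f s v) (f v).1.prev) c
          (pick (received G f s v) (f v).1.next) with _ | _ | c' <;>
          simp_all [Verdict.toState]
      obtain ⟨d, hd⟩ := exists_run_of_ne (hno w hvw) (hbefore s hs (by omega) w)
      have hpick := (horient s hs v (by rw [hc]; simp)).pick_eq_some hvw hd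
      rw [hw] at hpick
      rcases cellRule_eq_mark hrule with rfl | h | h
      · exact ihs (by omega) v hc w hvw hw
      · rw [hpick] at h
        exact ⟨s, hs, by omega, by rw [hd]; simpa using h⟩
      · simp [hpick] at h
  obtain ⟨hno, c, hc, hstep⟩ := exists_cell_of_run_succ (v := v) (t := t₁) (by rw [he]; simp)
    (ih v) (fun w _ => ih w)
  rw [he] at hstep
  have hrule : cellRule (pick (received G f t₁ v) (f v).1.prev) c
      (pick (received G f t₁ v) (f v).1.next) = .accept := by
    rcases hr : cellRule (pick (received G f t₁ v) (f v).1.prev) c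
      (pick (received G f t₁ v) (f v).1.next) with _ | _ | c'
    · rfl
    · rw [hr] at hstep; cases hstep
    · rw [hr] at hstep; cases hstep
  obtain ⟨hleft, hright⟩ := cellRule_eq_accept hrule
  have hv := horient t₁ ht₁ v (by rw [hc]; simp)
  have hvu : v ≠ u := by
    rintro rfl
    rw [run_eq_no_of_le ht₁ hu] at hc
    simp at hc
  have hnext : ∀ w, G.Adj v w → (f w).1 ≠ (f v).1.next := by
    intro w hw hl
    obtain ⟨d, hd⟩ := exists_run_of_ne (hno w hw) (ih w)
    have := hv.pick_eq_some hw hd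
    rw [hl, hright] at this
    cases this
  let M : V → Prop := fun w => ∃ s, t₀ ≤ s ∧ s ≤ t₁ ∧ run G f s w = .run (f w).1 .mark
  -- The walk to the left, starting at the accepting node `v`. All later nodes of the walk were
  -- marked at some time since `t₀`, so none of them is the rejecting node `u`.
  let R : V → V → Prop := fun a b => G.Adj a b ∧ (f b).1 = (f a).1.prev
  have hM : ∀ w, Relation.ReflTransGen R v w → w ≠ u ∧ IsOriented G f w ∧
      ∀ z, G.Adj w z → (f z).1 = (f w).1.prev → M z := by
    have hstepM : ∀ w, M w → w ≠ u ∧ IsOriented G f w ∧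
        ∀ z, G.Adj w z → (f z).1 = (f w).1.prev → M z := by
      rintro w ⟨s, hs, hs₁, hw⟩
      refine ⟨?_, horient s hs w (by rw [hw]; simp), hmarked s hs hs₁ w hw⟩
      rintro rfl
      rw [run_eq_no_of_le hs hu] at hw
      simp at hw
    intro w hw
    induction hw with
    | refl =>
      refine ⟨hvu, hv, fun z hz hl => ?_⟩
      obtain ⟨d, hd⟩ := exists_run_of_ne (hno z hz) (ih z)
      have := hv.pick_eq_some hz hd
      rw [hl, hleft] at this
      exact ⟨t₁, ht₁, le_rfl, by rw [hd]; simpa using this.symm⟩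
    | tail _ hbc ihb => exact hstepM _ (ihb.2.2 _ hbc.1 hbc.2)
  -- The walk exhausts the connected graph: `v` has no right neighbour, and the right neighbour of
  -- any later node is the one the walk came from.
  have hall : ∀ w, Relation.ReflTransGen R v w := by
    intro w
    have hvw := (SimpleGraph.reachable_iff_reflTransGen v w).1 (hG v w)
    induction hvw with
    | refl => exact .refl
    | @tail b d _ hbd hb =>
      rcases (hM b hb).2.1.label_eq d hbd with hl | hl
      · rcases Relation.ReflTransGen.cases_tail hb with rfl | ⟨a, ha, hab, hla⟩
        · exact absurd hl (hnext d hbd)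
        · rw [Label.eq_prev_iff] at hla
          rwa [(hM b hb).2.1.eq_of_label_eq d a hbd hab.symm (hl.trans hla.symm)]
      · exact hb.tail ⟨hbd, hl⟩
  exact (hM u (hall u)).1 rfl

end Graph

/-! ### Recognition of blocks -/

section Blocks

theorem isStart_shift (w : ℤ → Option Bool) (i j : ℤ) :
    IsStart (fun k => w (i + k)) j ↔ IsStart w (i + j) := by
  simp only [IsStart, IsBlock, ← add_assoc, add_sub_assoc]

theorem isBlock_congr {w w' : ℤ → Option Bool} {i : ℤ}
    (h : ∀ j, i ≤ j → j ≤ i + 3 → w j = w' j) : IsBlock w i ↔ IsBlock w' i := by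
  simp only [IsBlock]
  rw [h i (by omega) (by omega), h (i + 1) (by omega) (by omega), h (i + 2) (by omega) (by omega),
    h (i + 3) (by omega) (by omega)]

theorem isStart_congr {w w' : ℤ → Option Bool} {i : ℤ}
    (h : ∀ j, i - 4 ≤ j → j ≤ i + 3 → w j = w' j) : IsStart w i ↔ IsStart w' i := by
  rw [IsStart, IsStart, isBlock_congr (w := w) (w' := w') (i := i),
    isBlock_congr (w := w) (w' := w') (i := i - 4), h (i - 1) (by omega) (by omega)]
  · exact fun j h1 h2 => h j (by omega) (by omega)
  · exact fun j h1 h2 => h j (by omega) (by omega)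

/-- This window is why seven symbols are collected: the candidate start `i - 3` may depend on the
block at `i - 7`. -/
theorem isCovered_congr {w w' : ℤ → Option Bool} {i : ℤ}
    (h : ∀ j, i - 7 ≤ j → j ≤ i + 3 → w j = w' j) : IsCovered w i ↔ IsCovered w' i := by
  refine existsUnique_congr fun r => isStart_congr fun j h1 h2 => h j (by omega) (by omega)

theorem isCovered_shift (w : ℤ → Option Bool) (i j : ℤ) :
    IsCovered (fun k => w (i + k)) j ↔ IsCovered w (i + j) := by
  refine existsUnique_congr fun r => ?_
  rw [isStart_shift, add_sub_assoc]

theorem IsStart.ne_none {w : ℤ → Option Bool} {i : ℤ} (h : IsStart w i) (r : ℤ) (hr : 0 ≤ r)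
    (hr' : r < 4) : w (i + r) ≠ none := by
  obtain ⟨⟨x, h0, h1, h2, h3⟩, -⟩ := h
  interval_cases r <;> simp_all

/-- The defined positions of a word form an interval. -/
def IsInterval {α : Type} (w : ℤ → Option α) : Prop :=
  ∀ i j k, i ≤ j → j ≤ k → w i ≠ none → w k ≠ none → w j ≠ none

/-- The positions `i` and `i + 1` are covered by starts in windows that share three places. As each
window contains exactly one start, `i - 3` is a start iff `i + 1` is one; hence the starts have
period four along the interval. -/
theorem exists_isStart_iff {w : ℤ → Option Bool} (hw : IsInterval w) (hne : ∃ i, w i ≠ none)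
    (h : ∀ i, w i ≠ none → IsCovered w i) :
    ∃ i₀, IsStart w i₀ ∧ ∀ i, w i ≠ none → (IsStart w i ↔ (4 : ℤ) ∣ i - i₀) := by
  have h' : ∀ i, w i ≠ none → ∃ r : ℤ, 0 ≤ r ∧ r < 4 ∧ IsStart w (i - r) ∧
      ∀ s : ℤ, 0 ≤ s → s < 4 → IsStart w (i - s) → s = r := by
    intro i hi
    obtain ⟨r, hr, hu⟩ := h i hi
    refine ⟨(r : ℕ), by omega, by omega, hr, fun s hs hs' hst => ?_⟩
    have := hu ⟨s.toNat, by omega⟩ (by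
      simp only
      rwa [Int.toNat_of_nonneg hs])
    rw [← this]
    simp [hs]
  have hsucc : ∀ i, w i ≠ none → w (i + 1) ≠ none → (IsStart w (i - 3) ↔ IsStart w (i + 1)) := by
    intro i hi hi'
    obtain ⟨r, hr, hr', hs, hu⟩ := h' i hi
    obtain ⟨q, hq, hq', hs', hu'⟩ := h' (i + 1) hi'
    constructor
    · intro h3
      have := hu 3 (by norm_num) (by norm_num) h3
      by_cases hq0 : q = 0
      · simpa [hq0] using hs'
      · have := hu (q - 1) (by omega) (by omega) (by rwa [show i - (q - 1) = i + 1 - q by ring])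
        omega
    · intro h3
      have := hu' 0 (by norm_num) (by norm_num) (by simpa using h3)
      by_cases hr3 : r = 3
      · rwa [hr3] at hs
      · have := hu' (r + 1) (by omega) (by omega) (by rwa [show i + 1 - (r + 1) = i - r by ring])
        omega
  obtain ⟨i, hi⟩ := hne
  obtain ⟨r, hr, hr', hs, hu⟩ := h' i hi
  refine ⟨i - r, hs, ?_⟩
  -- The claim for the whole window of four places ending at `j` is what can be carried one step up
  -- or down.
  have hphase : ∀ j, w j ≠ none → ∀ s : ℤ, 0 ≤ s → s < 4 →
      (IsStart w (j - s) ↔ (4 : ℤ) ∣ j - s - (i - r)) := by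
    have hbase : ∀ s : ℤ, 0 ≤ s → s < 4 → (IsStart w (i - s) ↔ (4 : ℤ) ∣ i - s - (i - r)) := by
      intro s h0 h4
      constructor
      · intro hst
        rw [hu s h0 h4 hst]
        simp
      · intro hd
        rwa [show s = r by omega]
    have hup : ∀ n : ℕ, w (i + n) ≠ none → ∀ s : ℤ, 0 ≤ s → s < 4 →
        (IsStart w (i + n - s) ↔ (4 : ℤ) ∣ i + n - s - (i - r)) := by
      intro n
      induction n with
      | zero => simpa using fun _ => hbase
      | succ n ih =>
        intro hn s h0 h4
        have hn' : w (i + n) ≠ none := hw i _ _ (by omega) (by push_cast; omega) hi hn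
        push_cast at hn ⊢
        rw [← add_assoc] at hn ⊢
        by_cases hs0 : s = 0
        · rw [hs0, sub_zero, ← hsucc _ hn' hn, ih hn' 3 (by norm_num) (by norm_num)]
          omega
        · have := ih hn' (s - 1) (by omega) (by omega)
          rwa [show i + n - (s - 1) = i + n + 1 - s by ring] at this
    have hdown : ∀ n : ℕ, w (i - n) ≠ none → ∀ s : ℤ, 0 ≤ s → s < 4 →
        (IsStart w (i - n - s) ↔ (4 : ℤ) ∣ i - n - s - (i - r)) := by
      intro n
      induction n with
      | zero => simpa using fun _ => hbase
      | succ n ih =>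
        intro hn s h0 h4
        have hn' : w (i - n) ≠ none := hw _ _ _ (by push_cast; omega) (by omega) hn hi
        push_cast at hn ⊢
        have e := hsucc _ hn (by rwa [show i - (n + 1 : ℤ) + 1 = i - n by ring])
        rw [show i - (n + 1 : ℤ) + 1 = i - n by ring] at e
        by_cases hs3 : s = 3
        · have := ih hn' 0 (by norm_num) (by norm_num)
          rw [sub_zero] at this
          rw [hs3, e, this]
          omega
        · have := ih hn' (s + 1) (by omega) (by omega)
          rwa [show i - n - (s + 1) = i - (n + 1 : ℤ) - s by ring] at this
    intro j hj
    rcases le_total i j with hij | hij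
    · obtain ⟨n, rfl⟩ := Int.le.dest hij
      exact hup n hj
    · obtain ⟨n, hn⟩ := Int.le.dest hij
      obtain rfl : j = i - n := by omega
      exact hdown n hj
  intro j hj
  simpa using hphase j hj 0 le_rfl (by norm_num)

/-- A word that is a shifted prefix of length `4 * m` of the Thue–Morse sequence. -/
def IsThueMorsePrefix (w : ℤ → Option Bool) (i₀ : ℤ) (m : ℕ) : Prop :=
  (∀ n : ℕ, n < m → w (i₀ + n) = some (thueMorse n)) ∧
    ∀ i, w i ≠ none → i₀ ≤ i ∧ i < i₀ + m

/-- Offsets one and three contradict the pattern within at most two blocks. Offset two forces the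
current and the next term of the desubstituted sequence to agree; the block required four places
earlier forces the same of the previous and the current term, a cube. At offset two the left
neighbour exists, so the boundary clause cannot help. -/
theorem IsThueMorsePrefix.isStart_iff {w : ℤ → Option Bool} {i₀ : ℤ} {m : ℕ}
    (h : IsThueMorsePrefix w i₀ (4 * m)) (i : ℤ) (hi : w i ≠ none) :
    IsStart w i ↔ (4 : ℤ) ∣ i - i₀ := by
  obtain ⟨h1, h2⟩ := h
  have hblock : ∀ q : ℕ, q < m → IsBlock w (i₀ + 4 * q) := by
    intro q hq
    have a0 := h1 (4 * q) (by omega)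
    have a1 := h1 (4 * q + 1) (by omega)
    have a2 := h1 (4 * q + 2) (by omega)
    have a3 := h1 (4 * q + 3) (by omega)
    rw [thueMorse_four_mul] at a0
    rw [thueMorse_four_mul_add_one] at a1
    rw [thueMorse_four_mul_add_two] at a2
    rw [thueMorse_four_mul_add_three] at a3
    push_cast at a0 a1 a2 a3
    simp only [← add_assoc] at a1 a2 a3
    exact ⟨_, a0, a1, a2, a3⟩
  have hnone : ∀ i, i < i₀ → w i = none := by
    intro i hi
    by_contra hc
    have := (h2 i hc).1
    omega
  obtain ⟨g1, g2⟩ := h2 i hi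
  obtain ⟨n, rfl⟩ := Int.le.dest g1
  have hn : n < 4 * m := by omega
  constructor
  · rintro ⟨⟨x, x0, x1, x2, x3⟩, hb⟩
    have d3 := (h2 (i₀ + n + 3) (by rw [x3]; simp)).2
    have b0 := h1 n hn
    have b1 := h1 (n + 1) (by omega)
    have b2 := h1 (n + 2) (by omega)
    have b3 := h1 (n + 3) (by omega)
    push_cast at b1 b2 b3
    simp only [← add_assoc] at b1 b2 b3
    rw [x0] at b0
    rw [x1] at b1
    rw [x2] at b2
    rw [x3] at b3
    simp only [Option.some.injEq] at b0 b1 b2 b3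
    obtain ⟨q, r, hr, rfl⟩ : ∃ q r, r < 4 ∧ n = 4 * q + r :=
      ⟨n / 4, n % 4, Nat.mod_lt _ (by norm_num), (Nat.div_add_mod n 4).symm⟩
    have hr03 : r = 0 ∨ r = 1 ∨ r = 2 ∨ r = 3 := by omega
    rcases hr03 with rfl | rfl | rfl | rfl
    · push_cast; omega
    · exfalso
      rw [thueMorse_four_mul_add_one] at b0
      rw [show 4 * q + 1 + 1 = 4 * q + 2 by ring, thueMorse_four_mul_add_two, ← b0] at b1
      simp at b1
    · exfalso
      rw [thueMorse_four_mul_add_two] at b0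
      rw [show 4 * q + 2 + 2 = 4 * (q + 1) by ring, thueMorse_four_mul] at b2
      have e1 : thueMorse q = thueMorse (q + 1) := by rw [← b2, b0]; simp
      rcases hb with hb | ⟨y, y0, y1, y2, y3⟩
      · have := h1 (4 * q + 1) (by omega)
        rw [show i₀ + ((4 * q + 2 : ℕ) : ℤ) - 1 = i₀ + ((4 * q + 1 : ℕ) : ℤ) by push_cast; ring,
          this] at hb
        simp at hb
      · have hq : 0 < q := by
          by_contra hq
          have hy := hnone (i₀ + ((4 * q + 2 : ℕ) : ℤ) - 4) (by push_cast; omega)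
          rw [hy] at y0
          simp at y0
        obtain ⟨p, rfl⟩ : ∃ p, q = p + 1 := ⟨q - 1, by omega⟩
        have c0 := h1 (4 * p + 2) (by omega)
        have c2 := h1 (4 * (p + 1)) (by omega)
        rw [show i₀ + ((4 * (p + 1) + 2 : ℕ) : ℤ) - 4 = i₀ + ((4 * p + 2 : ℕ) : ℤ) by
          push_cast; ring, c0, thueMorse_four_mul_add_two] at y0
        rw [show i₀ + ((4 * (p + 1) + 2 : ℕ) : ℤ) - 4 + 2 = i₀ + ((4 * (p + 1) : ℕ) : ℤ) by
          push_cast; ring, c2, thueMorse_four_mul] at y2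
        simp only [Option.some.injEq] at y0 y2
        refine thueMorse_no_cube p ?_ e1
        rw [y2, ← y0, Bool.not_not]
    · exfalso
      rw [thueMorse_four_mul_add_three] at b0
      rw [show 4 * q + 3 + 1 = 4 * (q + 1) by ring, thueMorse_four_mul] at b1
      rw [show 4 * q + 3 + 2 = 4 * (q + 1) + 1 by ring, thueMorse_four_mul_add_one, ← b1] at b2
      simp at b2
  · intro hd
    obtain ⟨q, rfl⟩ : ∃ q : ℕ, n = 4 * q := ⟨n / 4, by omega⟩
    push_cast
    refine ⟨hblock q (by omega), ?_⟩
    by_cases hq : q = 0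
    · left
      exact hnone _ (by rw [hq]; simp)
    · right
      have := hblock (q - 1) (by omega)
      rwa [show i₀ + 4 * ((q - 1 : ℕ) : ℤ) = i₀ + 4 * (q : ℤ) - 4 by
        rw [Nat.cast_sub (by omega)]; push_cast; ring] at this

theorem IsThueMorsePrefix.isCovered {w : ℤ → Option Bool} {i₀ : ℤ} {m : ℕ}
    (h : IsThueMorsePrefix w i₀ (4 * m)) (i : ℤ) (hi : w i ≠ none) : IsCovered w i := by
  obtain ⟨g1, g2⟩ := h.2 i hi
  obtain ⟨n, rfl⟩ := Int.le.dest g1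
  have hw : ∀ r : Fin 4, (r : ℕ) ≤ n → w (i₀ + n - (r : ℕ)) ≠ none := by
    intro r hr
    have := h.1 (n - r) (by omega)
    rw [show i₀ + ((n - r : ℕ) : ℤ) = i₀ + n - (r : ℕ) by push_cast [hr]; ring] at this
    rw [this]; simp
  refine ⟨⟨n % 4, Nat.mod_lt _ (by norm_num)⟩, ?_, fun r hr => ?_⟩
  · have hle : n % 4 ≤ n := Nat.mod_le _ _
    exact (h.isStart_iff _ (hw _ hle)).2 (by simp only; omega)
  · have hne : w (i₀ + n - (r : ℕ)) ≠ none := by simpa using hr.ne_none 0 le_rfl (by norm_num)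
    have := (h.isStart_iff _ hne).1 hr
    ext
    simp only
    omega

end Blocks

/-! ### Tracks: paths and cycles indexed by the integers -/

theorem Letter.bit_ofBool (x : Bool) : (Letter.ofBool x).bit = some x := by cases x <;> rfl

theorem Letter.bit_eq_some_iff {c : Letter} {x : Bool} : c.bit = some x ↔ c = .ofBool x := by
  cases c <;> cases x <;> simp [Letter.bit, Letter.ofBool]

theorem Letter.bit_eq_none_iff {c : Letter} : c.bit = none ↔ c = .sep := by
  cases c <;> simp [Letter.bit]

theorem Letter.ofBool_injective : Function.Injective Letter.ofBool := by
  intro x y h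
  cases x <;> cases y <;> simp_all [Letter.ofBool]

variable {V : Type} {G : SimpleGraph V} {f : V → Label × Letter}

/-- A parametrization of all the nodes of a path or a cycle by the integers, where a cycle is
traversed again and again. -/
structure IsTrack (G : SimpleGraph V) (f : V → Label × Letter) (P : ℤ → Option V) : Prop where
  surj : ∀ v, ∃ i, P i = some v
  adj_iff : ∀ {i v}, P i = some v → ∀ {w}, G.Adj v w ↔ P (i - 1) = some w ∨ P (i + 1) = some w
  label_eq : ∀ {i v w}, P i = some v → P (i + 1) = some w → (f w).1 = (f v).1.next
  isInterval : IsInterval P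

namespace IsTrack

variable {P : ℤ → Option V} (hP : IsTrack G f P)

include hP

theorem label_prev {i : ℤ} {v w : V} (hv : P i = some v) (hw : P (i - 1) = some w) :
    (f w).1 = (f v).1.prev :=
  Label.eq_prev_iff.2 (hP.label_eq hw (by rwa [sub_add_cancel]))

theorem isOriented (v : V) : IsOriented G f v := by
  obtain ⟨i, hi⟩ := hP.surj v
  constructor
  · intro w hw
    rcases (hP.adj_iff hi).1 hw with h | h
    · exact Or.inr (hP.label_prev hi h)
    · exact Or.inl (hP.label_eq hi h)
  · intro w w' hw hw' hl
    rcases (hP.adj_iff hi).1 hw with h | h <;> rcases (hP.adj_iff hi).1 hw' with h' | h'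
    · exact Option.some.inj (h.symm.trans h')
    · rw [hP.label_prev hi h, hP.label_eq hi h'] at hl
      exact absurd hl (Label.prev_ne_next _)
    · rw [hP.label_prev hi h', hP.label_eq hi h] at hl
      exact absurd hl.symm (Label.prev_ne_next _)
    · exact Option.some.inj (h.symm.trans h')

/-- The labels separate the right neighbour from the left one, so the next place of the track
depends only on the current node. -/
theorem succ_eq {i j : ℤ} (h : P i = P j) (hi : P i ≠ none) : P (i + 1) = P (j + 1) := by
  have key : ∀ i j v w, P i = some v → P j = some v → P (i + 1) = some w →
      P (j + 1) = some w := by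
    intro i j v w hi hj hw
    have hadj := (hP.adj_iff hi).2 (Or.inr hw)
    rcases (hP.adj_iff hj).1 hadj with h | h
    · exact absurd ((hP.label_prev hj h).symm.trans (hP.label_eq hi hw)) (Label.prev_ne_next _)
    · exact h
  obtain ⟨v, hv⟩ := Option.ne_none_iff_exists'.1 hi
  ext w
  exact ⟨key i j v w hv (h ▸ hv), key j i v w (h ▸ hv) hv⟩

theorem add_eq {i j : ℤ} (h : P i = P j) (hi : P i ≠ none) (n : ℕ) : P (i + n) = P (j + n) := by
  induction n with
  | zero => simpa using h
  | succ n ih =>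
    push_cast
    rw [← add_assoc, ← add_assoc]
    by_cases hn : P (i + n) = none
    · have aux : ∀ i, P i ≠ none → P (i + n) = none → P (i + n + 1) = none := by
        intro i hi hn
        by_contra hc
        exact hP.isInterval i (i + n) (i + n + 1) (by omega) (by omega) hi hc hn
      rw [aux i hi hn, aux j (h ▸ hi) (ih ▸ hn)]
    · exact hP.succ_eq ih hn

theorem pred_eq {i j : ℤ} (h : P i = P j) (hi : P i ≠ none) : P (i - 1) = P (j - 1) := by
  have key : ∀ i j v w, P i = some v → P j = some v → P (i - 1) = some w →
      P (j - 1) = some w := by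
    intro i j v w hi hj hw
    have hadj := (hP.adj_iff hi).2 (Or.inl hw)
    rcases (hP.adj_iff hj).1 hadj with h | h
    · exact h
    · exact absurd ((hP.label_prev hi hw).symm.trans (hP.label_eq hj h)) (Label.prev_ne_next _)
  obtain ⟨v, hv⟩ := Option.ne_none_iff_exists'.1 hi
  ext w
  exact ⟨key i j v w hv (h ▸ hv), key j i v w (h ▸ hv) hv⟩

theorem sub_eq {i j : ℤ} (h : P i = P j) (hi : P i ≠ none) (n : ℕ) : P (i - n) = P (j - n) := by
  induction n with
  | zero => simpa using h
  | succ n ih =>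
    push_cast
    rw [← sub_sub, ← sub_sub]
    by_cases hn : P (i - n) = none
    · have aux : ∀ i, P i ≠ none → P (i - n) = none → P (i - n - 1) = none := by
        intro i hi hn
        by_contra hc
        exact hP.isInterval (i - n - 1) (i - n) i (by omega) (by omega) hc hi hn
      rw [aux i hi hn, aux j (h ▸ hi) (ih ▸ hn)]
    · exact hP.pred_eq ih hn

/-- A repetition would recur with period `j - i` and leave every bound. -/
theorem injective_of_bounded {m M : ℤ} (hM : ∀ i, P i ≠ none → m ≤ i ∧ i ≤ M) {i j : ℤ}
    (h : P i = P j) (hi : P i ≠ none) : i = j := by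
  have key : ∀ i j : ℤ, P i = P j → P i ≠ none → ¬ i < j := by
    intro i j h hi hij
    obtain ⟨p, hp⟩ := Int.le.dest hij.le
    have hn : ∀ n : ℕ, P (i + (n * p : ℕ)) ≠ none := by
      intro n
      induction n with
      | zero => simpa using hi
      | succ n ih =>
        rw [hP.add_eq h hi, ← hp] at ih
        convert ih using 2
        push_cast; ring
    have h1 := (hM _ (hn (M + 1 - i).toNat)).2
    have h2 := (hM i hi).2
    have h3 : (0 : ℤ) < p := by omega
    push_cast at h1
    rw [Int.toNat_of_nonneg (by omega)] at h1
    nlinarith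
  rcases lt_trichotomy i j with hij | hij | hij
  · exact absurd hij (key i j h hi)
  · exact hij
  · exact absurd hij (key j i h.symm (h ▸ hi))

theorem ncard_neighborSet {i : ℤ} {v : V} (hi : P i = some v) :
    (G.neighborSet v).ncard =
      (if P (i - 1) = none then 0 else 1) + (if P (i + 1) = none then 0 else 1) := by
  have hset : G.neighborSet v = {w | P (i - 1) = some w ∨ P (i + 1) = some w} := by
    ext w; exact hP.adj_iff hi
  rw [hset]
  rcases hl : P (i - 1) with _ | a <;> rcases hr : P (i + 1) with _ | b
  · simp
  · simp
  · simp
  · have hne : a ≠ b := by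
      rintro rfl
      exact Label.prev_ne_next _ ((hP.label_prev hi hl).symm.trans (hP.label_eq hi hr))
    have : {w | some a = some w ∨ some b = some w} = {a, b} := by
      ext w; simp [eq_comm]
    rw [this, Set.ncard_pair hne]
    simp

end IsTrack

/-! ### Unrolling an oriented graph -/

section Unroll

open Classical in
/-- The neighbour whose label is obtained with the function `l`. -/
noncomputable def neighborWith (G : SimpleGraph V) (f : V → Label × Letter) (l : Label → Label)
    (v : V) : Option V :=
  if h : ∃ w, G.Adj v w ∧ (f w).1 = l (f v).1 then some h.choose else none

theorem IsOriented.neighborWith_eq_some_iff {l : Label → Label} {v w : V}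
    (hv : IsOriented G f v) :
    neighborWith G f l v = some w ↔ G.Adj v w ∧ (f w).1 = l (f v).1 := by
  rw [neighborWith]
  split_ifs with h
  · rw [Option.some.injEq]
    constructor
    · rintro rfl; exact h.choose_spec
    · rintro ⟨hw, hl⟩
      exact hv.eq_of_label_eq _ _ h.choose_spec.1 hw (h.choose_spec.2.trans hl.symm)
  · simp only [false_iff]
    exact fun hw => h ⟨w, hw⟩

/-- The sequence of nodes that is obtained by walking from a node in both directions. -/
noncomputable def unroll (G : SimpleGraph V) (f : V → Label × Letter) (v : V) : ℤ → Option V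
  | .ofNat n => (fun o => o.bind (neighborWith G f Label.next))^[n] (some v)
  | .negSucc n => (fun o => o.bind (neighborWith G f Label.prev))^[n + 1] (some v)

theorem unroll_add_one (v : V) (n : ℕ) :
    unroll G f v (n + 1) = (unroll G f v n).bind (neighborWith G f Label.next) := by
  change (fun o : Option V => o.bind (neighborWith G f Label.next))^[n + 1] (some v) = _
  rw [Function.iterate_succ_apply']
  rfl

theorem unroll_sub_one (v : V) (n : ℕ) :
    unroll G f v (-n - 1) = (unroll G f v (-n)).bind (neighborWith G f Label.prev) := by
  have h : (-n - 1 : ℤ) = Int.negSucc n := by rw [Int.negSucc_eq]; ring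
  rw [h]
  cases n with
  | zero => rfl
  | succ n =>
    have h' : (-(n + 1 : ℕ) : ℤ) = Int.negSucc n := rfl
    rw [h']
    change (fun o : Option V => o.bind (neighborWith G f Label.prev))^[n + 1 + 1] (some v) = _
    rw [Function.iterate_succ_apply']
    rfl

/-- Being the right neighbour is the inverse relation of being the left neighbour, so the two
one-sided walks fit together; connectedness makes them reach every node. -/
theorem isTrack_unroll (hG : G.Connected) (h : ∀ v, IsOriented G f v) (v : V) :
    IsTrack G f (unroll G f v) := by
  have hflip : ∀ u w, neighborWith G f Label.next u = some w ↔
      neighborWith G f Label.prev w = some u := by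
    intro u w
    rw [(h u).neighborWith_eq_some_iff, (h w).neighborWith_eq_some_iff, Label.eq_prev_iff,
      G.adj_comm]
  have hsucc : ∀ i u, unroll G f v i = some u →
      unroll G f v (i + 1) = neighborWith G f Label.next u := by
    intro i u hu
    rcases le_or_gt 0 i with hi | hi
    · lift i to ℕ using hi
      rw [unroll_add_one, hu]; rfl
    · obtain ⟨n, rfl⟩ : ∃ n : ℕ, i = -n - 1 := ⟨(-i - 1).toNat, by omega⟩
      rw [unroll_sub_one, Option.bind_eq_some_iff] at hu
      obtain ⟨w, hw, hwu⟩ := hu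
      rw [sub_add_cancel, hw, ((hflip u w).2 hwu)]
  have hpred : ∀ i u, unroll G f v i = some u →
      unroll G f v (i - 1) = neighborWith G f Label.prev u := by
    intro i u hu
    rcases le_or_gt i 0 with hi | hi
    · obtain ⟨n, rfl⟩ : ∃ n : ℕ, i = -n := ⟨(-i).toNat, by omega⟩
      rw [unroll_sub_one, hu]; rfl
    · obtain ⟨n, rfl⟩ : ∃ n : ℕ, i = n + 1 := ⟨(i - 1).toNat, by omega⟩
      rw [unroll_add_one, Option.bind_eq_some_iff] at hu
      obtain ⟨w, hw, hwu⟩ := hu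
      rw [add_sub_cancel_right, hw, ((hflip w u).1 hwu)]
  have hadj : ∀ i u, unroll G f v i = some u → ∀ w,
      (G.Adj u w ↔ unroll G f v (i - 1) = some w ∨ unroll G f v (i + 1) = some w) := by
    intro i u hu w
    rw [hsucc i u hu, hpred i u hu, (h u).neighborWith_eq_some_iff,
      (h u).neighborWith_eq_some_iff]
    constructor
    · intro hw
      rcases (h u).label_eq w hw with hl | hl
      · exact Or.inr ⟨hw, hl⟩
      · exact Or.inl ⟨hw, hl⟩
    · rintro (hw | hw) <;> exact hw.1
  refine ⟨fun w => ?_, @fun i u hu w => hadj i u hu w, @fun i u w hu hw => ?_, ?_⟩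
  · have hvw := (SimpleGraph.reachable_iff_reflTransGen v w).1 (hG v w)
    induction hvw with
    | refl => exact ⟨0, rfl⟩
    | tail _ hbc ih =>
      obtain ⟨i, hi⟩ := ih
      rcases (hadj i _ hi _).1 hbc with h' | h'
      · exact ⟨_, h'⟩
      · exact ⟨_, h'⟩
  · rw [hsucc i u hu] at hw
    exact ((h u).neighborWith_eq_some_iff.1 hw).2
  · have hup : ∀ (n : ℕ) (m : ℕ), unroll G f v n = none → unroll G f v (n + m : ℕ) = none := by
      intro n m hn
      induction m with
      | zero => exact hn
      | succ m ih =>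
        rw [← add_assoc, Nat.cast_add (n + m) 1, Nat.cast_one, unroll_add_one, ih]; rfl
    have hdown : ∀ (n : ℕ) (m : ℕ), unroll G f v (-n) = none →
        unroll G f v (-(n + m : ℕ)) = none := by
      intro n m hn
      induction m with
      | zero => exact hn
      | succ m ih =>
        rw [show (-(n + (m + 1) : ℕ) : ℤ) = -(n + m : ℕ) - 1 by push_cast; ring,
          unroll_sub_one, ih]; rfl
    intro i j k hij hjk hi hk hj
    rcases le_or_gt 0 j with h0 | h0
    · lift j to ℕ using h0
      obtain ⟨m, rfl⟩ := Int.le.dest hjk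
      exact hk (hup j m hj)
    · obtain ⟨n, rfl⟩ : ∃ n : ℕ, j = -n := ⟨(-j).toNat, by omega⟩
      obtain ⟨m, hm⟩ := Int.le.dest hij
      obtain rfl : i = -(n + m : ℕ) := by push_cast; omega
      exact hi (hdown n m hj)

end Unroll

/-! ### Yes-instances as tracks -/

/-- The nodes of the track form a path that is labelled with a valid word. -/
def IsThueMorseTrack (f : V → Label × Letter) (P : ℤ → Option V) : Prop :=
  ∃ (K : ℕ) (b : ℤ), (∀ i, P i ≠ none ↔ b - 1 ≤ i ∧ i ≤ b + 2 * 4 ^ K - 1) ∧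
    ∀ (i : ℕ) (v : V), P (b - 1 + i) = some v → (f v).2 = thueMorseLetter i

theorem IsThueMorseYes.exists_isTrack (h : IsThueMorseYes G f) :
    ∃ P, IsTrack G f P ∧ IsThueMorseTrack f P := by
  obtain ⟨n, e, hl, hw⟩ := h
  obtain ⟨K, hn, hw⟩ := (validWord_ofFn_iff _ _).1 hw
  let P : ℤ → Option V := fun i =>
    if h : 0 ≤ i ∧ i < n then some (e ⟨i.toNat, by omega⟩) else none
  have hne : ∀ i, P i ≠ none ↔ 0 ≤ i ∧ i < n := by
    intro i; simp [P]
  have hsome : ∀ i v, P i = some v ↔ ∃ j : Fin n, (j : ℤ) = i ∧ e j = v := by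
    intro i v
    simp only [P]
    constructor
    · intro h
      split_ifs at h with hi
      exact ⟨⟨i.toNat, by omega⟩, by simp [hi.1], by simpa using h⟩
    · rintro ⟨j, rfl, rfl⟩
      rw [dif_pos (by omega)]
      simp
  refine ⟨P, ⟨fun v => ⟨(e.symm v : Fin n), (hsome _ _).2 ⟨_, rfl, e.apply_symm_apply v⟩⟩,
    @fun i v hv w => ?_, @fun i v w hv hw => ?_, ?_⟩, K, 1, fun i => ?_, fun i v hv => ?_⟩
  · obtain ⟨j, rfl, rfl⟩ := (hsome _ _).1 hv
    obtain ⟨j', rfl⟩ := e.surjective w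
    rw [hsome, hsome, e.map_adj_iff, SimpleGraph.pathGraph_adj]
    constructor
    · rintro (h | h)
      · exact Or.inr ⟨j', by omega, rfl⟩
      · exact Or.inl ⟨j', by omega, rfl⟩
    · rintro (⟨m, hm, he⟩ | ⟨m, hm, he⟩) <;> obtain rfl := e.injective he <;> omega
  · obtain ⟨j, rfl, rfl⟩ := (hsome _ _).1 hv
    obtain ⟨j', hj, rfl⟩ := (hsome _ _).1 hw
    exact hl j j' (by omega)
  · intro i j k hij hjk hi hk
    rw [hne] at *
    omega
  · rw [hne, hn]; push_cast; omega
  · obtain ⟨j, hj, rfl⟩ := (hsome _ _).1 hv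
    rw [hw j]
    congr 1
    omega

/-- The track of a valid word is bounded, hence injective, so the graph is a path and not a cycle.
-/
theorem IsTrack.isThueMorseYes {P : ℤ → Option V} (hP : IsTrack G f P)
    (h : IsThueMorseTrack f P) : IsThueMorseYes G f := by
  obtain ⟨K, b, hdom, hw⟩ := h
  have hex : ∀ i : Fin (2 * 4 ^ K + 1), ∃ v, P (b - 1 + (i : ℕ)) = some v := by
    intro i
    refine Option.ne_none_iff_exists'.1 ((hdom _).2 ⟨by omega, ?_⟩)
    have := i.2
    zify at this
    omega
  choose g hg using hex
  have hinj : ∀ i j, P i = P j → P i ≠ none → i = j := fun i j =>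
    hP.injective_of_bounded fun i hi => (hdom i).1 hi
  have hbij : Function.Bijective g := by
    constructor
    · intro i j hij
      have := hinj _ _ ((hg i).trans ((congrArg some hij).trans (hg j).symm)) (by rw [hg]; simp)
      ext
      omega
    · intro v
      obtain ⟨i, hi⟩ := hP.surj v
      obtain ⟨h1, h2⟩ := (hdom i).1 (by rw [hi]; simp)
      obtain ⟨n, rfl⟩ := Int.le.dest h1
      refine ⟨⟨n, by zify; omega⟩, ?_⟩
      have := hg ⟨n, by zify; omega⟩
      simp only at this
      rw [hi] at this
      simpa using this.symm
  refine ⟨_, ⟨Equiv.ofBijective g hbij, @fun i j => ?_⟩, fun i j hij => ?_, ?_⟩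
  · simp only [Equiv.ofBijective_apply]
    rw [hP.adj_iff (hg i), SimpleGraph.pathGraph_adj, ← hg j]
    constructor
    · rintro (h | h)
      · have := hinj _ _ h.symm (by rw [hg]; simp)
        omega
      · have := hinj _ _ h.symm (by rw [hg]; simp)
        omega
    · rintro (h | h)
      · right; congr 1; omega
      · left; congr 1; omega
  · refine hP.label_eq (hg i) ?_
    have := hg j
    rwa [hij, Nat.cast_add, Nat.cast_one, ← add_assoc] at this
  · exact (validWord_ofFn_iff _ _).2 ⟨K, rfl, fun i => hw i _ (hg i)⟩

/-! ### Runs as a cellular automaton on the integers -/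

/-- The states of the nodes in round `t` are given by the sequence `C` of cells. -/
def Represents (G : SimpleGraph V) (f : V → Label × Letter) (P : ℤ → Option V) (t : ℕ)
    (C : ℤ → Option Cell) : Prop :=
  (∀ i, P i = none → C i = none) ∧
    ∀ i v, P i = some v → ∃ c, C i = some c ∧ run G f t v = .run (f v).1 c

namespace Represents

variable {P : ℤ → Option V} {t : ℕ} {C : ℤ → Option Cell}

/-- The orientation recovers the left and the right cell from the unordered set of messages; from
here on the graph enters only through the track. -/
theorem run_succ (h : Represents G f P t C) (hP : IsTrack G f P) {i : ℤ} {v : V} {c : Cell}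
    (hv : P i = some v) (hc : C i = some c) :
    run G f (t + 1) v = (cellRule (C (i - 1)) c (C (i + 1))).toState (f v).1 := by
  have hrun : run G f t v = .run (f v).1 c := by
    obtain ⟨c', hc', hr⟩ := h.2 i v hv
    rw [hc] at hc'
    rwa [Option.some.inj hc']
  have hrun' : ∀ w, ∃ c, run G f t w = .run (f w).1 c := by
    intro w
    obtain ⟨j, hj⟩ := hP.surj w
    obtain ⟨c, -, hr⟩ := h.2 j w hj
    exact ⟨c, hr⟩
  rw [run_succ_of_run hrun]
  · congr 2
    · rcases hl : P (i - 1) with _ | w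
      · rw [h.1 _ hl, ← Option.not_isSome_iff_eq_none, Option.isSome_iff_exists]
        rintro ⟨d, hd⟩
        obtain ⟨w, hw, hwl, -⟩ := exists_adj_of_pick_eq_some hd
        rcases (hP.adj_iff hv).1 hw with h' | h'
        · rw [hl] at h'; cases h'
        · exact Label.prev_ne_next _ (hwl.symm.trans (hP.label_eq hv h'))
      · obtain ⟨d, hd, hr⟩ := h.2 _ w hl
        rw [hd, ← hP.label_prev hv hl]
        exact (hP.isOriented v).pick_eq_some ((hP.adj_iff hv).2 (Or.inl hl)) hr
    · rcases hl : P (i + 1) with _ | w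
      · rw [h.1 _ hl, ← Option.not_isSome_iff_eq_none, Option.isSome_iff_exists]
        rintro ⟨d, hd⟩
        obtain ⟨w, hw, hwl, -⟩ := exists_adj_of_pick_eq_some hd
        rcases (hP.adj_iff hv).1 hw with h' | h'
        · exact Label.prev_ne_next _ ((hP.label_prev hv h').symm.trans hwl)
        · rw [hl] at h'; cases h'
      · obtain ⟨d, hd, hr⟩ := h.2 _ w hl
        rw [hd, ← hP.label_eq hv hl]
        exact (hP.isOriented v).pick_eq_some ((hP.adj_iff hv).2 (Or.inr hl)) hr
  · intro w _ hw
    obtain ⟨d, hd⟩ := hrun' w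
    rw [hd] at hw; cases hw
  · intro w _ hw
    obtain ⟨d, hd⟩ := hrun' w
    rw [hd] at hw; cases hw

theorem succ (h : Represents G f P t C) (hP : IsTrack G f P) {C' : ℤ → Option Cell}
    (hnone : ∀ i, P i = none → C' i = none)
    (hstep : ∀ i c, P i ≠ none → C i = some c →
      ∃ c', cellRule (C (i - 1)) c (C (i + 1)) = .continue c' ∧ C' i = some c') :
    Represents G f P (t + 1) C' := by
  refine ⟨hnone, fun i v hv => ?_⟩
  obtain ⟨c, hc, -⟩ := h.2 i v hv
  obtain ⟨c', hr, hc'⟩ := hstep i c (by rw [hv]; simp) hc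
  exact ⟨c', hc', by rw [h.run_succ hP hv hc, hr]; rfl⟩

end Represents

variable {P : ℤ → Option V}

/-! ### One phase: the exchange of symbols -/

open Classical in
/-- The signals that are emitted by the active nodes in macro step `s`; the active nodes are the
nodes at the positions `b + d * q`, with the bits `a q`. -/
noncomputable def emitted (d b : ℤ) (a : ℤ → Option Bool) (s i : ℤ) : Option (Option Bool) :=
  if d ∣ i - b ∧ a ((i - b) / d) ≠ none then some (a ((i - b) / d + s)) else none

theorem emitted_of_not_dvd {d b : ℤ} {a : ℤ → Option Bool} {s i : ℤ} (h : ¬ d ∣ i - b) :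
    emitted d b a s i = none := by
  rw [emitted, if_neg fun h' => h h'.1]

theorem emitted_mul {d b : ℤ} (hd : 0 < d) (a : ℤ → Option Bool) (s q : ℤ) :
    emitted d b a s (b + d * q) = if a q = none then none else some (a (q + s)) := by
  rw [emitted, add_sub_cancel_left, Int.mul_ediv_cancel_left _ hd.ne']
  by_cases h : a q = none <;> simp [h]

/-- The symbols at distance at most `s` in direction `ε` from `q`. -/
def known (a : ℤ → Option Bool) (ε q : ℤ) (s : Fin 7) (j : Fin 7) : Option Bool :=
  if j < s then a (q + ε * ((j : ℕ) + 1)) else none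

open Classical in
/-- The cells in step `τ` of macro step `s`. -/
noncomputable def phaseCell (P : ℤ → Option V) (d b : ℤ) (a : ℤ → Option Bool) (s : Fin 7)
    (τ i : ℤ) : Option Cell :=
  if P i = none then none
  else if d ∣ i - b then
    some (.active ((a ((i - b) / d)).getD false) s (known a (-1) ((i - b) / d) s)
      (known a 1 ((i - b) / d) s) (emitted d b a (-(s : ℕ)) (i - τ))
      (emitted d b a (s : ℕ) (i + τ)))
  else some (.relay (emitted d b a (-(s : ℕ)) (i - τ)) (emitted d b a (s : ℕ) (i + τ)))

section Phase

variable {d b : ℤ} {a : ℤ → Option Bool}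

theorem phaseCell_of_none {s : Fin 7} {τ i : ℤ} (h : P i = none) :
    phaseCell P d b a s τ i = none := by
  rw [phaseCell, if_pos h]

theorem phaseCell_of_not_dvd {s : Fin 7} {τ i : ℤ} (h : P i ≠ none) (hi : ¬ d ∣ i - b) :
    phaseCell P d b a s τ i = some (.relay (emitted d b a (-(s : ℕ)) (i - τ))
      (emitted d b a (s : ℕ) (i + τ))) := by
  rw [phaseCell, if_neg h, if_neg hi]

theorem phaseCell_mul (hd : 0 < d) {s : Fin 7} {τ q : ℤ} {x : Bool} (h : P (b + d * q) ≠ none)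
    (hx : a q = some x) :
    phaseCell P d b a s τ (b + d * q) = some (.active x s (known a (-1) q s) (known a 1 q s)
      (emitted d b a (-(s : ℕ)) (b + d * q - τ)) (emitted d b a (s : ℕ) (b + d * q + τ))) := by
  rw [phaseCell, if_neg h, if_pos (by simp), add_sub_cancel_left,
    Int.mul_ediv_cancel_left _ hd.ne', hx]
  rfl

theorem phaseCell_ne_mark (s : Fin 7) (τ i : ℤ) : phaseCell P d b a s τ i ≠ some .mark := by
  rw [phaseCell]; split_ifs <;> simp

theorem phaseCell_ne_finish (s : Fin 7) (τ i : ℤ) : phaseCell P d b a s τ i ≠ some .finish := by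
  rw [phaseCell]; split_ifs <;> simp

theorem relayRule_phaseCell (s : Fin 7) (τ i j : ℤ) :
    relayRule (phaseCell P d b a s τ i) (phaseCell P d b a s τ j) =
      .continue (.relay ((phaseCell P d b a s τ i).bind Cell.toRight)
        ((phaseCell P d b a s τ j).bind Cell.toLeft)) := by
  rw [relayRule, if_neg (phaseCell_ne_mark _ _ _),
    if_neg fun h => phaseCell_ne_finish _ _ _ h.2]

variable (hd : 1 < d) (hint : IsInterval P) (hsym : ∀ q, a q ≠ none ↔ P (b + d * q) ≠ none)

include hsym in
theorem ne_none_of_emitted_ne_none {s i : ℤ} (h : emitted d b a s i ≠ none) : P i ≠ none := by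
  rw [emitted] at h
  split_ifs at h with hi
  · have := (hsym _).1 hi.2
    rwa [Int.mul_ediv_cancel' hi.1, add_sub_cancel] at this
  · exact absurd rfl h

include hd hint hsym

theorem isInterval_symbols : IsInterval a := by
  intro i j k hij hjk hi hk
  rw [hsym] at hi hk ⊢
  refine hint _ _ _ ?_ ?_ hi hk <;> nlinarith

omit hd in
-- At the left end nothing arrives, and the closed form agrees: a signal would have been emitted
-- outside the track, which is an interval.
theorem phaseCell_toRight {s : Fin 7} {τ i : ℤ} (hi : P i ≠ none) (hτ : 0 ≤ τ) :
    (phaseCell P d b a s τ (i - 1)).bind Cell.toRight =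
      emitted d b a (-(s : ℕ)) (i - (τ + 1)) := by
  have e : i - 1 - τ = i - (τ + 1) := by ring
  by_cases h : P (i - 1) = none
  · rw [phaseCell_of_none h]
    symm
    by_contra hc
    exact hint _ _ _ (by omega) (by omega) (ne_none_of_emitted_ne_none hsym hc) hi h
  · rw [phaseCell, if_neg h, e]
    split_ifs <;> rfl

omit hd in
theorem phaseCell_toLeft {s : Fin 7} {τ i : ℤ} (hi : P i ≠ none) (hτ : 0 ≤ τ) :
    (phaseCell P d b a s τ (i + 1)).bind Cell.toLeft =
      emitted d b a (s : ℕ) (i + (τ + 1)) := by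
  have e : i + 1 + τ = i + (τ + 1) := by ring
  by_cases h : P (i + 1) = none
  · rw [phaseCell_of_none h]
    symm
    by_contra hc
    exact hint _ _ _ (by omega) (by omega) hi (ne_none_of_emitted_ne_none hsym hc) h
  · rw [phaseCell, if_neg h, e]
    split_ifs <;> rfl

/-- After fewer than `d` steps each signal is strictly between two active nodes, so the active nodes
idle and the relays shift the signals. -/
theorem Represents.phase_step (hP : IsTrack G f P) {t : ℕ} {s : Fin 7} {τ : ℤ} (hτ : 0 ≤ τ)
    (hτd : τ + 1 < d) (h : Represents G f P t (phaseCell P d b a s τ)) :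
    Represents G f P (t + 1) (phaseCell P d b a s (τ + 1)) := by
  refine h.succ hP (fun i hi => phaseCell_of_none hi) fun i c hi hc => ?_
  have hr := phaseCell_toRight hint hsym (s := s) hi hτ
  have hl := phaseCell_toLeft hint hsym (s := s) hi hτ
  by_cases hdvd : d ∣ i - b
  · obtain ⟨q, hq⟩ := hdvd
    obtain rfl : i = b + d * q := by omega
    obtain ⟨x, hx⟩ := Option.ne_none_iff_exists'.1 ((hsym q).2 hi)
    have h1 : ¬ d ∣ b + d * q - (τ + 1) - b := by
      rw [show b + d * q - (τ + 1) - b = d * q - (τ + 1) by ring, dvd_sub_right ⟨q, rfl⟩]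
      exact fun h' => absurd (Int.le_of_dvd (by omega) h') (by omega)
    have h2 : ¬ d ∣ b + d * q + (τ + 1) - b := by
      rw [show b + d * q + (τ + 1) - b = d * q + (τ + 1) by ring, dvd_add_right ⟨q, rfl⟩]
      exact fun h' => absurd (Int.le_of_dvd (by omega) h') (by omega)
    rw [emitted_of_not_dvd h1] at hr
    rw [emitted_of_not_dvd h2] at hl
    rw [phaseCell_mul (by omega) hi hx, Option.some.injEq] at hc
    subst hc
    refine ⟨_, ?_, phaseCell_mul (by omega) hi hx⟩
    rw [cellRule_active, activeRule, hr, hl, emitted_of_not_dvd h1, emitted_of_not_dvd h2]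
    simp
  · rw [phaseCell_of_not_dvd hi hdvd, Option.some.injEq] at hc
    subst hc
    refine ⟨_, ?_, phaseCell_of_not_dvd hi hdvd⟩
    rw [cellRule_relay, relayRule_phaseCell, hr, hl]

/-- The symbols that arrive at an active node at the end of a macro step. -/
theorem emitted_join {q : ℤ} (hq : a q ≠ none) (s : ℕ) :
    (emitted d b a (-s) (b + d * q - d)).join = a (q - 1 - s) ∧
      (emitted d b a s (b + d * q + d)).join = a (q + 1 + s) := by
  have hia := isInterval_symbols hd hint hsym
  rw [show b + d * q - d = b + d * (q - 1) by ring, show b + d * q + d = b + d * (q + 1) by ring,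
    emitted_mul (by omega), emitted_mul (by omega)]
  constructor
  · split_ifs with h
    · symm
      by_contra hc
      exact hia (q - 1 - s) (q - 1) q (by omega) (by omega) hc hq h
    · rfl
  · split_ifs with h
    · symm
      by_contra hc
      exact hia q (q + 1) (q + 1 + s) (by omega) (by omega) hq hc h
    · rfl

omit hd hint hsym in
theorem update_known (ε q : ℤ) (s : Fin 7) (hs : s ≠ 6) :
    Function.update (known a ε q s) s (a (q + ε * ((s : ℕ) + 1))) = known a ε q (s + 1) := by
  funext j
  have hs1 : ((s + 1 : Fin 7) : ℕ) = s + 1 := by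
    rw [Fin.val_add_one_of_lt]
    exact lt_of_le_of_ne (Fin.le_last s) hs
  by_cases hj : j = s
  · subst hj
    rw [Function.update_self, known, if_pos]
    rw [Fin.lt_def, hs1]; omega
  · rw [Function.update_of_ne hj, known, known]
    have hj' : (j : ℕ) ≠ s := fun h => hj (Fin.ext h)
    have : j < s ↔ j < s + 1 := by
      rw [Fin.lt_def, Fin.lt_def, hs1]; omega
    simp only [this]

variable (hns : ∀ q, a q ≠ none → a (q - 1) ≠ none ∨ a (q + 1) ≠ none)

include hns

omit hint hsym in
-- An active node with an active neighbour gets at least one signal after `d` rounds, and so notices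
-- the end of the traversal.
theorem emitted_ne_none {q s s' : ℤ} (hq : a q ≠ none) :
    ¬ (emitted d b a s (b + d * q - d) = none ∧ emitted d b a s' (b + d * q + d) = none) := by
  rw [show b + d * q - d = b + d * (q - 1) by ring, show b + d * q + d = b + d * (q + 1) by ring,
    emitted_mul (by omega), emitted_mul (by omega)]
  rintro ⟨h1, h2⟩
  split_ifs at h1 h2
  have := hns q hq
  tauto

/-- All signals reach the next active node in the same round; they are stored as entry `s` and
re-emitted, now as symbols at distance `s + 1`. -/
theorem Represents.macro_step (hP : IsTrack G f P) {t : ℕ} {s : Fin 7} (hs : s ≠ 6)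
    (h : Represents G f P t (phaseCell P d b a s (d - 1))) :
    Represents G f P (t + 1) (phaseCell P d b a (s + 1) 0) := by
  refine h.succ hP (fun i hi => phaseCell_of_none hi) fun i c hi hc => ?_
  have hr := phaseCell_toRight hint hsym (s := s) hi (show 0 ≤ d - 1 by omega)
  have hl := phaseCell_toLeft hint hsym (s := s) hi (show 0 ≤ d - 1 by omega)
  rw [sub_add_cancel] at hr hl
  by_cases hdvd : d ∣ i - b
  · obtain ⟨q, hq⟩ := hdvd
    obtain rfl : i = b + d * q := by omega
    have haq := (hsym q).2 hi
    obtain ⟨x, hx⟩ := Option.ne_none_iff_exists'.1 haq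
    obtain ⟨j1, j2⟩ := emitted_join hd hint hsym haq s
    have hs1 : ((s + 1 : Fin 7) : ℕ) = s + 1 := by
      rw [Fin.val_add_one_of_lt]
      exact lt_of_le_of_ne (Fin.le_last s) hs
    rw [phaseCell_mul (by omega) hi hx, Option.some.injEq] at hc
    subst hc
    refine ⟨_, ?_, phaseCell_mul (by omega) hi hx⟩
    rw [cellRule_active, activeRule, hr, hl]
    simp only
    rw [if_neg (emitted_ne_none hd hns haq), if_neg hs, j1, j2, ← update_known _ _ _ hs,
      ← update_known _ _ _ hs, sub_zero, add_zero, emitted_mul (by omega), emitted_mul (by omega),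
      if_neg haq, if_neg haq, hs1]
    push_cast
    rw [show q + -1 * ((s : ℕ) + 1 : ℤ) = q - 1 - (s : ℕ) by ring,
      show q + 1 * ((s : ℕ) + 1 : ℤ) = q + 1 + (s : ℕ) by ring,
      show q + -((s : ℕ) + 1 : ℤ) = q - 1 - (s : ℕ) by ring,
      show q + ((s : ℕ) + 1 : ℤ) = q + 1 + (s : ℕ) by ring]
  · have h1 : ¬ d ∣ i - d - b := by
      rwa [show i - d - b = i - b - d by ring, dvd_sub_self_right]
    have h2 : ¬ d ∣ i + d - b := by
      rwa [show i + d - b = i - b + d by ring, dvd_add_self_right]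
    rw [emitted_of_not_dvd h1] at hr
    rw [emitted_of_not_dvd h2] at hl
    rw [phaseCell_of_not_dvd hi hdvd, Option.some.injEq] at hc
    subst hc
    refine ⟨_, ?_, phaseCell_of_not_dvd hi hdvd⟩
    rw [cellRule_relay, relayRule_phaseCell, hr, hl, sub_zero, add_zero,
      emitted_of_not_dvd hdvd, emitted_of_not_dvd hdvd]

omit hd hint hsym hns in
theorem localWord_update_known {q : ℤ} {x : Bool} (hx : a q = some x) (j : ℤ) (h1 : -7 ≤ j)
    (h2 : j ≤ 7) :
    localWord x (Function.update (known a (-1) q 6) 6 (a (q - 1 - 6)))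
      (Function.update (known a 1 q 6) 6 (a (q + 1 + 6))) j = a (q + j) := by
  have key : ∀ (ε : ℤ) (i : Fin 7), Function.update (known a ε q 6) 6 (a (q + ε * 7)) i =
      a (q + ε * ((i : ℕ) + 1)) := by
    intro ε i
    by_cases hi : i = 6
    · subst hi
      rw [Function.update_self]
      rfl
    · rw [Function.update_of_ne hi, known, if_pos]
      exact lt_of_le_of_ne (Fin.le_last i) hi
  have k1 := key (-1)
  have k2 := key 1
  rw [show q + -1 * 7 = q - 1 - 6 by ring] at k1
  rw [show q + 1 * 7 = q + 1 + 6 by ring] at k2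
  rw [localWord]
  split_ifs with h0 h3 h4
  · rw [h0, add_zero, hx]
  · rw [k2]
    congr 1
    simp only
    omega
  · rw [k1]
    congr 1
    simp only
    omega
  · omega

omit hd hint hsym hns in
theorem decideBlock_congr {x : Bool} {w w' : ℤ → Option Bool}
    (h : ∀ j, -7 ≤ j → j ≤ 7 → w j = w' j) : decideBlock x w = decideBlock x w' := by
  have h1 : IsCovered w 0 ↔ IsCovered w' 0 :=
    isCovered_congr fun j h1 h2 => h j (by omega) (by omega)
  have h2 : IsStart w 0 ↔ IsStart w' 0 :=
    isStart_congr fun j h1 h2 => h j (by omega) (by omega)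
  rw [decideBlock, decideBlock, h (-1) (by norm_num) (by norm_num),
    h 4 (by norm_num) (by norm_num)]
  split_ifs <;> first | rfl | tauto

omit hd hint hsym hns in
open Classical in
/-- The states after the decisions of the active nodes. -/
noncomputable def decision (d b : ℤ) (a : ℤ → Option Bool) (i : ℤ) : Verdict :=
  if d ∣ i - b then
    decideBlock ((a ((i - b) / d)).getD false) fun j => a ((i - b) / d + j)
  else .continue (.relay none none)

theorem Represents.decision_step (hP : IsTrack G f P) {t : ℕ}
    (h : Represents G f P t (phaseCell P d b a 6 (d - 1))) {i : ℤ} {v : V} (hv : P i = some v) :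
    run G f (t + 1) v = (decision d b a i).toState (f v).1 := by
  have hi : P i ≠ none := by rw [hv]; simp
  have hr := phaseCell_toRight hint hsym (s := 6) hi (show 0 ≤ d - 1 by omega)
  have hl := phaseCell_toLeft hint hsym (s := 6) hi (show 0 ≤ d - 1 by omega)
  rw [sub_add_cancel] at hr hl
  by_cases hdvd : d ∣ i - b
  · rw [decision, if_pos hdvd]
    obtain ⟨q, hq⟩ := hdvd
    obtain rfl : i = b + d * q := by omega
    have haq := (hsym q).2 hi
    obtain ⟨x, hx⟩ := Option.ne_none_iff_exists'.1 haq
    obtain ⟨j1, j2⟩ := emitted_join hd hint hsym haq 6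
    rw [h.run_succ hP hv (phaseCell_mul (by omega) hi hx), cellRule_active, activeRule, hr, hl]
    simp only
    rw [if_neg (emitted_ne_none hd hns haq), if_pos trivial, add_sub_cancel_left,
      Int.mul_ediv_cancel_left _ (by omega), hx]
    congr 1
    refine decideBlock_congr fun j h1 h2 => ?_
    rw [← localWord_update_known hx j h1 h2]
    congr 2
  · have h1 : ¬ d ∣ i - d - b := by
      rwa [show i - d - b = i - b - d by ring, dvd_sub_self_right]
    have h2 : ¬ d ∣ i + d - b := by
      rwa [show i + d - b = i - b + d by ring, dvd_add_self_right]
    rw [emitted_of_not_dvd h1] at hr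
    rw [emitted_of_not_dvd h2] at hl
    rw [h.run_succ hP hv (phaseCell_of_not_dvd hi hdvd), cellRule_relay, relayRule_phaseCell, hr,
      hl, decision, if_neg hdvd]

omit hns in
theorem Represents.macro_round (hP : IsTrack G f P) {t : ℕ} {s : Fin 7}
    (h : Represents G f P t (phaseCell P d b a s 0)) :
    Represents G f P (t + (d.toNat - 1)) (phaseCell P d b a s (d - 1)) := by
  have key : ∀ n : ℕ, (n : ℤ) < d → Represents G f P (t + n) (phaseCell P d b a s n) := by
    intro n
    induction n with
    | zero => exact fun _ => h
    | succ n ih =>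
      intro hn
      push_cast at hn ⊢
      exact (ih (by omega)).phase_step hd hint hsym hP (by omega) hn
  have := key (d.toNat - 1) (by omega)
  rwa [show ((d.toNat - 1 : ℕ) : ℤ) = d - 1 by omega] at this

theorem Represents.phase (hP : IsTrack G f P) {t : ℕ}
    (h : Represents G f P t (phaseCell P d b a 0 0)) {i : ℤ} {v : V} (hv : P i = some v) :
    run G f (t + 7 * d.toNat) v = (decision d b a i).toState (f v).1 := by
  have key : ∀ n : ℕ, ∀ hn : n < 7,
      Represents G f P (t + n * d.toNat) (phaseCell P d b a ⟨n, hn⟩ 0) := by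
    intro n
    induction n with
    | zero => exact fun _ => by simpa using h
    | succ n ih =>
      intro hn
      have hne : (⟨n, by omega⟩ : Fin 7) ≠ 6 := fun h => by
        have : n = 6 := congrArg Fin.val h
        omega
      have := ((ih (by omega)).macro_round hd hint hsym hP).macro_step hd hint hsym hns hP hne
      have e1 : (⟨n, by omega⟩ + 1 : Fin 7) = ⟨n + 1, hn⟩ := by
        ext
        rw [Fin.val_add_one_of_lt]
        exact lt_of_le_of_ne (Fin.le_last _) hne
      rw [e1] at this
      rwa [show t + n * d.toNat + (d.toNat - 1) + 1 = t + (n + 1) * d.toNat by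
        have : 1 ≤ d.toNat := by omega
        rw [add_mul, one_mul]; omega] at this
  have := ((key 6 (by norm_num)).macro_round hd hint hsym hP).decision_step hd hint hsym hns
    hP hv
  rwa [show t + 6 * d.toNat + (d.toNat - 1) + 1 = t + 7 * d.toNat by omega] at this

end Phase

/-! ### Levels: undoing the substitution -/

/-- The distance of neighbouring active nodes at level `k`. -/
def spacing (k : ℕ) : ℤ := 2 * 4 ^ k

theorem spacing_succ (k : ℕ) : spacing (k + 1) = 4 * spacing k := by
  rw [spacing, spacing, pow_succ]; ring

theorem one_lt_spacing (k : ℕ) : 1 < spacing k := by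
  have : (0 : ℤ) < 4 ^ k := by positivity
  rw [spacing]; omega

theorem two_dvd_spacing (k : ℕ) : (2 : ℤ) ∣ spacing k := ⟨4 ^ k, rfl⟩

/-- The letters along the track are obtained from the bits `a` by substituting `k` times. The bit
`a q` is held by the node at the position `b + spacing k * q`. -/
structure IsLevel (f : V → Label × Letter) (P : ℤ → Option V) (k : ℕ) (b : ℤ)
    (a : ℤ → Option Bool) : Prop where
  symbol : ∀ q, a q ≠ none ↔ P (b + spacing k * q) ≠ none
  block : ∀ q, a q ≠ none →
    P (b + spacing k * q - 1) ≠ none ∧ P (b + spacing k * q + spacing k - 1) ≠ none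
  cover : ∀ i, P i ≠ none → ∃ q, a q ≠ none ∧ b + spacing k * q - 1 ≤ i ∧
    i ≤ b + spacing k * q + spacing k - 1
  letter_symbol : ∀ q x (s : ℕ) v, a q = some x → s < 4 ^ k →
    P (b + spacing k * q + 2 * s) = some v → (f v).2 = .ofBool (xor x (thueMorse s))
  letter_sep : ∀ i v, P i = some v → ¬ (2 : ℤ) ∣ i - b → (f v).2 = .sep

open Classical in
/-- The states at the beginning of a level. -/
noncomputable def levelVerdict (d b : ℤ) (a : ℤ → Option Bool) (i : ℤ) : Verdict :=
  if d ∣ i - b then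
    spawn ((a ((i - b) / d)).getD false) (a ((i - b) / d - 1)).isNone (a ((i - b) / d + 1)).isNone
  else .continue (.relay none none)

theorem levelVerdict_mul {d b : ℤ} (hd : 0 < d) {a : ℤ → Option Bool} {q : ℤ} {x : Bool}
    (hx : a q = some x) :
    levelVerdict d b a (b + d * q) = spawn x (a (q - 1)).isNone (a (q + 1)).isNone := by
  rw [levelVerdict, if_pos (by simp), add_sub_cancel_left, Int.mul_ediv_cancel_left _ hd.ne', hx]
  rfl

theorem levelVerdict_of_not_dvd {d b : ℤ} {a : ℤ → Option Bool} {i : ℤ} (h : ¬ d ∣ i - b) :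
    levelVerdict d b a i = .continue (.relay none none) := by
  rw [levelVerdict, if_neg h]

theorem decision_mul {d b : ℤ} (hd : 0 < d) {a : ℤ → Option Bool} {q : ℤ} {x : Bool}
    (hx : a q = some x) :
    decision d b a (b + d * q) = decideBlock x fun j => a (q + j) := by
  rw [decision, if_pos (by simp), add_sub_cancel_left, Int.mul_ediv_cancel_left _ hd.ne', hx]
  rfl

theorem decision_of_not_dvd {d b : ℤ} {a : ℤ → Option Bool} {i : ℤ} (h : ¬ d ∣ i - b) :
    decision d b a i = .continue (.relay none none) := by
  rw [decision, if_neg h]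

theorem spawn_ne_relay (x first last : Bool) (s s') :
    spawn x first last ≠ .continue (.relay s s') := by
  cases x <;> cases first <;> cases last <;> simp [spawn]

theorem Verdict.toState_injective (l : Label) : Function.Injective (Verdict.toState l) := by
  intro x y h
  cases x <;> cases y <;> simp_all [Verdict.toState]

/-- In round `t` the nodes are at the beginning of a level. -/
def AtLevel (G : SimpleGraph V) (f : V → Label × Letter) (P : ℤ → Option V) (t : ℕ) (d b : ℤ)
    (a : ℤ → Option Bool) : Prop :=
  ∀ i v, P i = some v → run G f t v = (levelVerdict d b a i).toState (f v).1

namespace IsLevel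

variable {k : ℕ} {b : ℤ} {a : ℤ → Option Bool} (h : IsLevel f P k b a)

include h

theorem isInterval (hP : IsTrack G f P) : IsInterval a :=
  isInterval_symbols (one_lt_spacing k) hP.isInterval h.symbol

/-- On a cycle, different places may be the same node. If two places of one block were, then
shifting both back would put the active first node also at a place that is no multiple of the
spacing, where nodes are silent relays. This bounds the number of levels. -/
theorem spacing_le_card [Finite V] (hP : IsTrack G f P) {t : ℕ}
    (ht : AtLevel G f P t (spacing k) b a) {q : ℤ} (hq : a q ≠ none) :
    2 * 4 ^ k ≤ Nat.card V := by
  have hd := one_lt_spacing k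
  have hdom : ∀ ρ : ℤ, 0 ≤ ρ → ρ < spacing k → P (b + spacing k * q + ρ) ≠ none :=
    fun ρ h0 h1 => hP.isInterval _ _ _ (by omega) (by omega) ((h.symbol q).1 hq) (h.block q hq).2
  have hcast : ((2 * 4 ^ k : ℕ) : ℤ) = spacing k := by rw [spacing]; push_cast; rfl
  have hex : ∀ ρ : Fin (2 * 4 ^ k), ∃ v, P (b + spacing k * q + (ρ : ℕ)) = some v := by
    intro ρ
    refine Option.ne_none_iff_exists'.1 (hdom _ (by omega) ?_)
    have := ρ.2
    zify at this
    omega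
  choose g hg using hex
  have hlt : ∀ ρ ρ' : Fin (2 * 4 ^ k), (ρ : ℕ) < ρ' → g ρ ≠ g ρ' := by
    intro ρ ρ' hlt he
    have h1 := hg ρ
    have h2 := hg ρ'
    rw [he, ← h2] at h1
    have h3 := hP.sub_eq h1 (by rw [h1, h2]; simp) ρ
    rw [add_sub_cancel_right] at h3
    obtain ⟨v, hv⟩ := Option.ne_none_iff_exists'.1 ((h.symbol q).1 hq)
    obtain ⟨x, hx⟩ := Option.ne_none_iff_exists'.1 hq
    have h4 := ht _ v hv
    rw [hv] at h3
    have h5 := ht _ v h3.symm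
    rw [h4] at h5
    have h6 := Verdict.toState_injective _ h5
    rw [levelVerdict_mul (by omega) hx, levelVerdict_of_not_dvd] at h6
    · exact spawn_ne_relay _ _ _ _ _ h6
    · rw [show b + spacing k * q + ((ρ' : ℕ) : ℤ) - ((ρ : ℕ) : ℤ) - b =
        spacing k * q + (((ρ' : ℕ) : ℤ) - ((ρ : ℕ) : ℤ)) by ring, dvd_add_right ⟨q, rfl⟩]
      intro hdvd
      have := Int.le_of_dvd (by omega) hdvd
      have := ρ'.2
      zify at this
      omega
  have hinj : Function.Injective g := by
    intro ρ ρ' he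
    rcases lt_trichotomy (ρ : ℕ) ρ' with h' | h' | h'
    · exact absurd he (hlt _ _ h')
    · exact Fin.ext h'
    · exact absurd he.symm (hlt _ _ h')
  simpa using Nat.card_le_card_of_injective g hinj

theorem represents (hns : ∀ q, a q ≠ none → a (q - 1) ≠ none ∨ a (q + 1) ≠ none) {t : ℕ}
    (ht : AtLevel G f P t (spacing k) b a) :
    Represents G f P t (phaseCell P (spacing k) b a 0 0) := by
  have hd := one_lt_spacing k
  refine ⟨fun i hi => phaseCell_of_none hi, fun i v hv => ?_⟩
  have hi : P i ≠ none := by rw [hv]; simp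
  have hrun := ht i v hv
  by_cases hdvd : spacing k ∣ i - b
  · obtain ⟨q, hq⟩ := hdvd
    obtain rfl : i = b + spacing k * q := by omega
    have haq := (h.symbol q).2 hi
    obtain ⟨x, hx⟩ := Option.ne_none_iff_exists'.1 haq
    refine ⟨_, phaseCell_mul (by omega) hi hx, ?_⟩
    have hk : ∀ ε, known a ε q 0 = fun _ => none := fun ε => funext fun j => by simp [known]
    have hsp : ((a (q - 1)).isNone && (a (q + 1)).isNone) = false := by
      have := hns q haq
      cases h1 : a (q - 1) <;> cases h2 : a (q + 1) <;> simp_all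
    rw [hrun, levelVerdict_mul (by omega) hx, spawn, hsp, hk, hk, sub_zero, add_zero,
      emitted_mul (by omega), emitted_mul (by omega), if_neg haq, if_neg haq]
    simp [Verdict.toState, hx]
  · refine ⟨_, phaseCell_of_not_dvd hi hdvd, ?_⟩
    rw [hrun, levelVerdict_of_not_dvd hdvd, sub_zero, add_zero, emitted_of_not_dvd hdvd,
      emitted_of_not_dvd hdvd]
    rfl

/-- The starts form a residue class modulo four, and their bits are the word of the next level. The
local decisions produce exactly its initial states. -/
theorem exists_succ (hP : IsTrack G f P) (hne : ∃ q, a q ≠ none)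
    (hcov : ∀ q, a q ≠ none → IsCovered a q) :
    ∃ b' a', IsLevel f P (k + 1) b' a' ∧
      ∀ i, P i ≠ none → decision (spacing k) b a i = levelVerdict (spacing (k + 1)) b' a' i := by
  have hd := one_lt_spacing k
  have hia := h.isInterval hP
  obtain ⟨i₀, h₀, hstart⟩ := exists_isStart_iff hia hne hcov
  have hpos : ∀ q, b + spacing k * i₀ + spacing (k + 1) * q = b + spacing k * (i₀ + 4 * q) := by
    intro q; rw [spacing_succ]; ring
  have hst : ∀ q, a (i₀ + 4 * q) ≠ none → IsStart a (i₀ + 4 * q) :=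
    fun q hq => (hstart _ hq).2 (by simp)
  have hcover : ∀ q, a q ≠ none → ∃ p r : ℤ, 0 ≤ r ∧ r < 4 ∧ q = i₀ + 4 * p + r ∧
      IsStart a (i₀ + 4 * p) := by
    intro q hq
    obtain ⟨r, hr, -⟩ := hcov q hq
    have h1 : a (q - (r : ℕ)) ≠ none := by simpa using hr.ne_none 0 le_rfl (by norm_num)
    obtain ⟨p, hp⟩ := (hstart _ h1).1 hr
    have e : q - (r : ℕ) = i₀ + 4 * p := by omega
    exact ⟨p, (r : ℕ), by omega, by omega, by omega, e ▸ hr⟩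
  refine ⟨b + spacing k * i₀, fun q => a (i₀ + 4 * q), ⟨fun q => ?_, fun q hq => ?_, fun i hi => ?_,
    fun q x s v hx hs hv => ?_, fun i v hv hdvd => h.letter_sep i v hv fun h2 => hdvd ?_⟩,
    fun i hi => ?_⟩
  · rw [hpos]; exact h.symbol _
  · rw [hpos]
    refine ⟨(h.block _ hq).1, ?_⟩
    have := (h.block _ ((hst q hq).ne_none 3 (by norm_num) (by norm_num))).2
    rw [spacing_succ]
    convert this using 2
    ring
  · obtain ⟨q, hq, h1, h2⟩ := h.cover i hi
    obtain ⟨p, r, hr0, hr4, rfl, hs⟩ := hcover q hq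
    refine ⟨p, by simpa using hs.ne_none 0 le_rfl (by norm_num), ?_, ?_⟩
    · rw [hpos]; nlinarith
    · rw [hpos, spacing_succ]; nlinarith
  · rw [hpos] at hv
    obtain ⟨⟨y, y0, y1, y2, y3⟩, -⟩ := hst q (by rw [hx]; simp)
    obtain rfl : x = y := by simpa [hx] using y0
    have h4 : 0 < 4 ^ k := by positivity
    -- The quotient selects one of the four old bits of the block, the remainder the place within
    -- that bit's own block.
    have hr : s / 4 ^ k < 4 := by rw [Nat.div_lt_iff_lt_mul h4, ← pow_succ']; exact hs
    have hes := Nat.div_add_mod s (4 ^ k)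
    have hm := Nat.mod_lt s h4
    generalize hr' : s / 4 ^ k = r at *
    generalize s % 4 ^ k = s' at *
    subst hes
    rw [thueMorse_pow_mul_add k _ _ hm, ← Bool.xor_assoc]
    refine h.letter_symbol (i₀ + 4 * q + r) _ s' v ?_ hm ?_
    · have t0 := thueMorse_zero
      have t1 := thueMorse_four_mul_add_one 0
      have t2 := thueMorse_four_mul_add_two 0
      have t3 := thueMorse_four_mul_add_three 0
      interval_cases r <;> simp_all
    · rw [← hv]
      congr 1
      rw [spacing]
      push_cast
      ring
  · obtain ⟨c, hc⟩ := h2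
    obtain ⟨e, he⟩ := two_dvd_spacing k
    refine ⟨c - e * i₀, ?_⟩
    rw [he, mul_sub, ← hc]; ring
  · by_cases hdvd : spacing k ∣ i - b
    · obtain ⟨q, hq⟩ := hdvd
      obtain rfl : i = b + spacing k * q := by omega
      have haq := (h.symbol q).2 hi
      obtain ⟨x, hx⟩ := Option.ne_none_iff_exists'.1 haq
      have hc0 : IsCovered (fun j => a (q + j)) 0 := by
        rw [isCovered_shift, add_zero]; exact hcov q haq
      rw [decision_mul (by omega) hx, decideBlock, if_pos hc0]
      by_cases hs : IsStart a q
      · have hs0 : IsStart (fun j => a (q + j)) 0 := by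
          rwa [isStart_shift, add_zero]
        obtain ⟨p, hp⟩ := (hstart q haq).1 hs
        obtain rfl : q = i₀ + 4 * p := by omega
        rw [if_pos hs0, ← hpos, levelVerdict_mul (a := fun q => a (i₀ + 4 * q))
          (by rw [spacing_succ]; omega) hx]
        have e1 : i₀ + 4 * (p + 1) = i₀ + 4 * p + 4 := by ring
        -- A symbol just before the block lies in a block itself, whose start is the preceding
        -- survivor; so looking one symbol to the left detects it.
        have e2 : (a (i₀ + 4 * p + -1)).isNone = (a (i₀ + 4 * (p - 1))).isNone := by
          rw [Bool.eq_iff_iff, Option.isNone_iff_eq_none, Option.isNone_iff_eq_none, ← not_iff_not]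
          constructor
          · intro hn
            obtain ⟨p', r, hr0, hr4, he, hs'⟩ := hcover _ hn
            obtain rfl : p' = p - 1 := by omega
            simpa using hs'.ne_none 0 le_rfl (by norm_num)
          · intro hn
            exact hia _ _ _ (by omega) (by omega) hn haq
        rw [e1, e2]
      · have hs0 : ¬ IsStart (fun j => a (q + j)) 0 := by
          rwa [isStart_shift, add_zero]
        rw [if_neg hs0, levelVerdict_of_not_dvd]
        rintro ⟨c, hc⟩
        refine hs ((hstart q haq).2 ⟨c, ?_⟩)
        rw [spacing_succ] at hc
        have : spacing k * (q - i₀) = spacing k * (4 * c) := by linarith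
        exact mul_left_cancel₀ (by omega) this
    · rw [decision_of_not_dvd hdvd, levelVerdict_of_not_dvd]
      rintro ⟨c, hc⟩
      refine hdvd ⟨i₀ + 4 * c, ?_⟩
      rw [spacing_succ] at hc
      linarith

/-- If only one active node is left, with the bit zero, then the word is valid. -/
theorem isThueMorseTrack (hP : IsTrack G f P) {q : ℤ} (hq : a q = some false)
    (hsingle : ∀ p, a p ≠ none → p = q) : IsThueMorseTrack f P := by
  have hd := one_lt_spacing k
  obtain ⟨b1, b2⟩ := h.block q (by rw [hq]; simp)
  refine ⟨k, b + spacing k * q, fun i => ?_, fun i v hv => ?_⟩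
  · change _ ↔ _ ∧ i ≤ b + spacing k * q + spacing k - 1
    constructor
    · intro hi
      obtain ⟨p, hp, h1⟩ := h.cover i hi
      rwa [hsingle p hp] at h1
    · rintro ⟨h1, h2⟩
      exact hP.isInterval _ _ _ h1 h2 b1 b2
  · obtain ⟨p, hp, h1, h2⟩ := h.cover _ (show P _ ≠ none by rw [hv]; simp)
    rw [hsingle p hp] at h1 h2
    rcases Nat.even_or_odd' i with ⟨s, rfl | rfl⟩
    · rw [thueMorseLetter_even]
      refine h.letter_sep _ v hv ?_
      obtain ⟨e, he⟩ := two_dvd_spacing k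
      rintro ⟨c, hc⟩
      rw [he, mul_assoc] at hc
      push_cast at hc
      omega
    · rw [thueMorseLetter_odd]
      have := h.letter_symbol q false s v hq ?_ ?_
      · simpa using this
      · zify
        rw [spacing] at h2
        push_cast at h2
        linarith
      · rw [← hv]
        congr 1
        push_cast
        ring

/-- The bits at the level `k` of a valid word. -/
theorem exists_isThueMorsePrefix (hT : IsThueMorseTrack f P) :
    ∃ q₀ m, IsThueMorsePrefix a q₀ (4 ^ m) := by
  obtain ⟨K, c, hdom, hletter⟩ := hT
  have hd := one_lt_spacing k
  have h4K : (0 : ℤ) < 4 ^ K := by positivity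
  obtain ⟨q₀, hq₀, h1, h2⟩ := h.cover (c - 1) ((hdom _).2 ⟨le_rfl, by linarith⟩)
  obtain ⟨g1, g2⟩ := h.block q₀ hq₀
  have hc : c = b + spacing k * q₀ := by
    have := ((hdom _).1 g1).1
    omega
  -- A whole block of level `k` fits into the path of the valid word.
  have hkK : k ≤ K := by
    have := ((hdom _).1 g2).2
    have h3 : (4 : ℤ) ^ k ≤ 4 ^ K := by rw [spacing] at *; linarith
    have h5 : (4 : ℕ) ^ k ≤ 4 ^ K := by exact_mod_cast h3
    exact (Nat.pow_le_pow_iff_right (by norm_num)).1 h5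
  obtain ⟨m, rfl⟩ := Nat.exists_eq_add_of_le hkK
  have hne : ∀ n : ℤ, a (q₀ + n) ≠ none ↔ 0 ≤ n ∧ n < 4 ^ m := by
    intro n
    have e1 : b + spacing k * (q₀ + n) = c + spacing k * n := by rw [hc]; ring
    have e2 : (2 : ℤ) * 4 ^ (k + m) = spacing k * 4 ^ m := by rw [spacing, pow_add]; ring
    rw [h.symbol, hdom, e1, e2]
    constructor
    · rintro ⟨h1, h2⟩
      constructor
      · by_contra! hn
        nlinarith
      · by_contra! hn
        nlinarith
    · rintro ⟨h1, h2⟩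
      constructor
      · nlinarith
      · nlinarith
  refine ⟨q₀, m, fun n hn => ?_, fun i hi => ?_⟩
  · obtain ⟨x, hx⟩ := Option.ne_none_iff_exists'.1 ((hne n).2 ⟨by omega, by exact_mod_cast hn⟩)
    obtain ⟨v, hv⟩ := Option.ne_none_iff_exists'.1 ((h.symbol (q₀ + n)).1 (by rw [hx]; simp))
    have l1 := h.letter_symbol _ x 0 v hx (by positivity) (by simpa using hv)
    have l2 := hletter (2 * (4 ^ k * n) + 1) v (by
      rw [← hv]
      congr 1
      rw [hc, spacing]
      push_cast
      ring)
    have l3 := thueMorse_pow_mul_add k n 0 (by positivity)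
    rw [thueMorseLetter_odd] at l2
    rw [add_zero, thueMorse_zero, Bool.xor_false] at l3
    rw [l1, l3, thueMorse_zero, Bool.xor_false] at l2
    rw [hx, Letter.ofBool_injective l2]
  · have := (hne (i - q₀)).1 (by rwa [add_sub_cancel])
    push_cast
    omega

end IsLevel

/-! ### The first round -/

theorem cellRule_raw_some {l r : Option Cell} {e x : Bool}
    (h : cellRule l (.raw e (some x)) r ≠ .reject) :
    ∃ e₁ e₂, l = some (.raw e₁ none) ∧ r = some (.raw e₂ none) ∧
      cellRule l (.raw e (some x)) r = spawn x e₁ e₂ := by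
  rw [cellRule.eq_def] at h ⊢
  split at h <;> simp_all

theorem cellRule_raw_none {l r : Option Cell} {e : Bool}
    (h : cellRule l (.raw e none) r ≠ .reject) :
    cellRule l (.raw e none) r = .continue (.relay none none) ∧
      ((∃ e₁ x, l = some (.raw e₁ (some x))) ∨ ∃ e₂ y, r = some (.raw e₂ (some y))) ∧
      (∀ e₁, l ≠ some (.raw e₁ none)) ∧ ∀ e₂, r ≠ some (.raw e₂ none) := by
  rw [cellRule.eq_def] at h ⊢
  split at h <;> simp_all

open Classical in
/-- The cells before the first round. -/
noncomputable def rawCell (G : SimpleGraph V) (f : V → Label × Letter) (P : ℤ → Option V) (i : ℤ) :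
    Option Cell :=
  (P i).map fun v => .raw (decide ((G.neighborSet v).ncard = 1)) (f v).2.bit

theorem represents_rawCell (h : ∀ v, run G f 0 v ≠ .no) :
    Represents G f P 0 (rawCell G f P) := by
  refine ⟨fun i hi => by rw [rawCell, hi]; rfl, fun i v hv => ⟨_, by rw [rawCell, hv]; rfl, ?_⟩⟩
  have hv := h v
  rw [run_zero, initialState] at hv ⊢
  split_ifs at hv ⊢ with h1 h2
  · simp [h1.1, h1.2, Letter.bit]
  · simp [h2]
  · exact absurd rfl hv

/-- If no node rejects in the first round, then the separators alternate with the symbols. -/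
theorem IsTrack.exists_isLevel_zero (hP : IsTrack G f P) [Nonempty V]
    (h : ∀ v, run G f 1 v ≠ .no) :
    ∃ b a, (∃ q, a q ≠ none) ∧ IsLevel f P 0 b a ∧ AtLevel G f P 1 (spacing 0) b a := by
  have hrep : Represents G f P 0 (rawCell G f P) :=
    represents_rawCell fun v h0 => h v (run_eq_no_of_le zero_le_one h0)
  have hrule : ∀ i v, P i = some v → cellRule (rawCell G f P (i - 1))
      (.raw (decide ((G.neighborSet v).ncard = 1)) (f v).2.bit) (rawCell G f P (i + 1)) ≠ .reject := by
    intro i v hv hr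
    have := hrep.run_succ hP hv (c := .raw (decide ((G.neighborSet v).ncard = 1)) (f v).2.bit)
      (by rw [rawCell, hv]; rfl)
    rw [hr] at this
    exact h v this
  have hrun : ∀ i v, P i = some v → run G f 1 v = (cellRule (rawCell G f P (i - 1))
      (.raw (decide ((G.neighborSet v).ncard = 1)) (f v).2.bit)
      (rawCell G f P (i + 1))).toState (f v).1 := fun i v hv =>
    hrep.run_succ hP hv (by rw [rawCell, hv]; rfl)
  have hraw : ∀ i e s, rawCell G f P i = some (.raw e s) →
      ∃ v, P i = some v ∧ e = decide ((G.neighborSet v).ncard = 1) ∧ (f v).2.bit = s := by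
    intro i e s hi
    rw [rawCell, Option.map_eq_some_iff] at hi
    obtain ⟨v, hv, he⟩ := hi
    rw [Cell.raw.injEq] at he
    exact ⟨v, hv, he.1.symm, he.2⟩
  have hsym : ∀ i v x, P i = some v → (f v).2.bit = some x →
      ∃ u w, P (i - 1) = some u ∧ P (i + 1) = some w ∧ (f u).2.bit = none ∧ (f w).2.bit = none ∧
        run G f 1 v = (spawn x (decide ((G.neighborSet u).ncard = 1))
          (decide ((G.neighborSet w).ncard = 1))).toState (f v).1 := by
    intro i v x hv hx
    have h1 := hrule i v hv
    have h2 := hrun i v hv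
    rw [hx] at h1 h2
    obtain ⟨e₁, e₂, hl, hr, he⟩ := cellRule_raw_some h1
    obtain ⟨u, hu, rfl, hu'⟩ := hraw _ _ _ hl
    obtain ⟨w, hw, rfl, hw'⟩ := hraw _ _ _ hr
    exact ⟨u, w, hu, hw, hu', hw', by rw [h2, he]⟩
  have hsep : ∀ i v, P i = some v → (f v).2.bit = none →
      run G f 1 v = .run (f v).1 (.relay none none) ∧
      ((∃ u, P (i - 1) = some u ∧ (f u).2.bit ≠ none) ∨
        ∃ w, P (i + 1) = some w ∧ (f w).2.bit ≠ none) ∧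
      (∀ u, P (i - 1) = some u → (f u).2.bit ≠ none) ∧
      ∀ w, P (i + 1) = some w → (f w).2.bit ≠ none := by
    intro i v hv hx
    have h1 := hrule i v hv
    have h2 := hrun i v hv
    rw [hx] at h1 h2
    obtain ⟨he, hex, hl, hr⟩ := cellRule_raw_none h1
    refine ⟨by rw [h2, he]; rfl, ?_, fun u hu hn => ?_, fun w hw hn => ?_⟩
    · rcases hex with ⟨e, x, hx⟩ | ⟨e, x, hx⟩
      · obtain ⟨u, hu, -, hu'⟩ := hraw _ _ _ hx
        exact Or.inl ⟨u, hu, by rw [hu']; simp⟩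
      · obtain ⟨u, hu, -, hu'⟩ := hraw _ _ _ hx
        exact Or.inr ⟨u, hu, by rw [hu']; simp⟩
    · exact hl (decide ((G.neighborSet u).ncard = 1)) (by rw [rawCell, hu]; simp [hn])
    · exact hr (decide ((G.neighborSet w).ncard = 1)) (by rw [rawCell, hw]; simp [hn])
  let S : ℤ → Option Bool := fun i => (P i).bind fun v => (f v).2.bit
  have hS : ∀ {i v}, P i = some v → S i = (f v).2.bit := by
    intro i v hv
    simp only [S, hv, Option.bind_some]
  have hSP : ∀ {i}, S i ≠ none → P i ≠ none := by
    intro i hi hn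
    simp only [S, hn, Option.bind_none, ne_eq, not_true_eq_false] at hi
  have hsucc : ∀ i, P i ≠ none → P (i + 1) ≠ none → (S i ≠ none ↔ S (i + 1) = none) := by
    intro i hi hi'
    obtain ⟨v, hv⟩ := Option.ne_none_iff_exists'.1 hi
    obtain ⟨w, hw⟩ := Option.ne_none_iff_exists'.1 hi'
    rw [hS hv, hS hw]
    constructor
    · intro hn
      obtain ⟨x, hx⟩ := Option.ne_none_iff_exists'.1 hn
      obtain ⟨u, w', -, hw', -, hb, -⟩ := hsym i v x hv hx
      rw [hw] at hw'
      rwa [Option.some.inj hw']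
    · intro hn
      exact (hsep _ w hw hn).2.2.1 v (by rwa [add_sub_cancel_right])
  obtain ⟨b, hb⟩ : ∃ b, S b ≠ none := by
    obtain ⟨v⟩ := ‹Nonempty V›
    obtain ⟨i, hi⟩ := hP.surj v
    by_cases hv : (f v).2.bit = none
    · rcases (hsep i v hi hv).2.1 with ⟨u, hu, hu'⟩ | ⟨u, hu, hu'⟩
      · exact ⟨_, by rwa [hS hu]⟩
      · exact ⟨_, by rwa [hS hu]⟩
    · exact ⟨i, by rwa [hS hi]⟩
  have hpar : ∀ i, P i ≠ none → (S i ≠ none ↔ (2 : ℤ) ∣ i - b) := by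
    have hup : ∀ n : ℕ, P (b + n) ≠ none → (S (b + n) ≠ none ↔ (2 : ℤ) ∣ b + n - b) := by
      intro n
      induction n with
      | zero => simpa using fun _ => hb
      | succ n ih =>
        intro hn
        have hn' := hP.isInterval b (b + n) _ (by omega) (by push_cast; omega) (hSP hb) hn
        have e : b + ((n + 1 : ℕ) : ℤ) = b + n + 1 := by push_cast; ring
        rw [e] at hn ⊢
        have h1 := hsucc _ hn' hn
        have h2 := ih hn'
        rw [h1] at h2
        rw [ne_eq, h2]
        omega
    have hdown : ∀ n : ℕ, P (b - n) ≠ none → (S (b - n) ≠ none ↔ (2 : ℤ) ∣ b - n - b) := by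
      intro n
      induction n with
      | zero => simpa using fun _ => hb
      | succ n ih =>
        intro hn
        have hn' := hP.isInterval _ (b - n) b (by push_cast; omega) (by omega) hn (hSP hb)
        have e : b - (n : ℤ) = b - ((n + 1 : ℕ) : ℤ) + 1 := by push_cast; ring
        have h2 := ih hn'
        rw [e] at hn' h2
        rw [hsucc _ hn hn', ← not_iff_not, ← ne_eq, h2]
        push_cast
        omega
    intro i hi
    rcases le_total b i with hbi | hbi
    · obtain ⟨n, rfl⟩ := Int.le.dest hbi
      exact hup n hi
    · obtain ⟨n, hn⟩ := Int.le.dest hbi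
      obtain rfl : i = b - n := by omega
      exact hdown n hi
  have hsp : spacing 0 = 2 := by simp [spacing]
  have hmem : ∀ q, S (b + 2 * q) ≠ none ↔ P (b + 2 * q) ≠ none := fun q =>
    ⟨hSP, fun hq => (hpar _ hq).2 (by simp)⟩
  refine ⟨b, fun q => S (b + 2 * q), ⟨0, by simpa using hb⟩, ⟨fun q => ?_, fun q hq => ?_,
    fun i hi => ?_, fun q x s v hx hs hv => ?_, fun i v hv hdvd => ?_⟩, fun i v hv => ?_⟩
  · rw [hsp]; exact hmem q
  · obtain ⟨v, hv⟩ := Option.ne_none_iff_exists'.1 ((hmem q).1 hq)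
    obtain ⟨x, hx⟩ := Option.ne_none_iff_exists'.1 hq
    rw [hS hv] at hx
    obtain ⟨u, w, hu, hw, -⟩ := hsym _ v x hv hx
    rw [hsp, show b + 2 * q + 2 - 1 = b + 2 * q + 1 by ring, hu, hw]
    simp
  · rw [hsp]
    by_cases hdvd : (2 : ℤ) ∣ i - b
    · obtain ⟨q, hq⟩ := hdvd
      obtain rfl : i = b + 2 * q := by omega
      exact ⟨q, (hmem q).2 hi, by omega, by omega⟩
    · obtain ⟨v, hv⟩ := Option.ne_none_iff_exists'.1 hi
      have hn : (f v).2.bit = none := by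
        rw [← hS hv]
        by_contra hc
        exact hdvd ((hpar i hi).1 hc)
      rcases (hsep i v hv hn).2.1 with ⟨u, hu, hu'⟩ | ⟨u, hu, hu'⟩
      · refine ⟨(i - 1 - b) / 2, ?_, by omega, by omega⟩
        rw [← hS hu] at hu'
        convert hu' using 2
        omega
      · refine ⟨(i + 1 - b) / 2, ?_, by omega, by omega⟩
        rw [← hS hu] at hu'
        convert hu' using 2
        omega
  · obtain rfl : s = 0 := by simpa using hs
    rw [hsp, Nat.cast_zero, mul_zero, add_zero] at hv
    rw [hS hv] at hx
    rw [thueMorse_zero, Bool.xor_false]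
    exact Letter.bit_eq_some_iff.1 hx
  · rw [← Letter.bit_eq_none_iff, ← hS hv]
    by_contra hc
    exact hdvd ((hpar i (by rw [hv]; simp)).1 hc)
  · have hi : P i ≠ none := by rw [hv]; simp
    rw [hsp]
    by_cases hdvd : (2 : ℤ) ∣ i - b
    · obtain ⟨q, hq⟩ := hdvd
      obtain rfl : i = b + 2 * q := by omega
      obtain ⟨x, hx⟩ := Option.ne_none_iff_exists'.1 ((hmem q).2 hi)
      rw [levelVerdict_mul (by norm_num) (a := fun q => S (b + 2 * q)) hx]
      rw [hS hv] at hx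
      obtain ⟨u, w, hu, hw, -, -, hr⟩ := hsym _ v x hv hx
      rw [hr]
      -- At level zero a bit is the first one iff the separator to its left has degree one; the
      -- right side is symmetric.
      congr 2
      · rw [Bool.eq_iff_iff, decide_eq_true_iff, Option.isNone_iff_eq_none, ← not_iff_not (b := _ = none),
          ← ne_eq, ← ne_eq, hmem, hP.ncard_neighborSet hu, sub_add_cancel, hv,
          show b + 2 * q - 1 - 1 = b + 2 * (q - 1) by ring]
        by_cases hc : P (b + 2 * (q - 1)) = none <;> simp [hc]
      · rw [Bool.eq_iff_iff, decide_eq_true_iff, Option.isNone_iff_eq_none, ← not_iff_not (b := _ = none),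
          ← ne_eq, ← ne_eq, hmem, hP.ncard_neighborSet hw, add_sub_cancel_right, hv,
          show b + 2 * q + 1 + 1 = b + 2 * (q + 1) by ring]
        by_cases hc : P (b + 2 * (q + 1)) = none <;> simp [hc]
    · rw [levelVerdict_of_not_dvd hdvd]
      refine (hsep i v hv ?_).1
      rw [← hS hv]
      by_contra hc
      exact hdvd ((hpar i hi).1 hc)

/-- In a yes-instance no node rejects in the first round. -/
theorem IsTrack.run_one_ne_no (hP : IsTrack G f P) (hT : IsThueMorseTrack f P) (v : V) :
    run G f 1 v ≠ .no := by
  obtain ⟨K, c, hdom, hletter⟩ := hT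
  have h4 : (0 : ℤ) < 4 ^ K := by positivity
  have hne : ∀ j : ℤ, P (c - 1 + j) = none ↔ ¬ (0 ≤ j ∧ j ≤ 2 * 4 ^ K) := by
    intro j
    rw [← not_iff_not, ← ne_eq, hdom, not_not]
    constructor <;> rintro ⟨h1, h2⟩ <;> constructor <;> linarith
  have hpos : ∀ v, ∃ j : ℕ, P (c - 1 + j) = some v ∧ (j : ℤ) ≤ 2 * 4 ^ K := by
    intro v
    obtain ⟨i, hi⟩ := hP.surj v
    obtain ⟨h1, h2⟩ := (hdom i).1 (by rw [hi]; simp)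
    obtain ⟨j, rfl⟩ := Int.le.dest h1
    exact ⟨j, hi, by linarith⟩
  have hcard : ∀ (j : ℕ) v, P (c - 1 + j) = some v → (j : ℤ) ≤ 2 * 4 ^ K →
      (G.neighborSet v).ncard = (if j = 0 then 0 else 1) + if (j : ℤ) = 2 * 4 ^ K then 0 else 1 := by
    intro j v hv hj
    rw [hP.ncard_neighborSet hv]
    have e1 : P (c - 1 + j - 1) = none ↔ j = 0 := by
      rw [show c - 1 + (j : ℤ) - 1 = c - 1 + (j - 1) by ring, hne]
      omega
    have e2 : P (c - 1 + j + 1) = none ↔ (j : ℤ) = 2 * 4 ^ K := by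
      rw [show c - 1 + (j : ℤ) + 1 = c - 1 + (j + 1) by ring, hne]
      omega
    simp only [e1, e2]
  have hzero : ∀ v, run G f 0 v ≠ .no := by
    intro v
    obtain ⟨j, hv, hj⟩ := hpos v
    rw [run_zero, initialState, hcard j v hv hj, hletter j v hv]
    by_cases h0 : j = 0
    · have h1 : ¬ ((0 : ℤ) = 2 * 4 ^ K) := by omega
      subst h0
      simp [h1, thueMorseLetter]
    · by_cases h1 : (j : ℤ) = 2 * 4 ^ K
      · have h2 : thueMorseLetter j = .sep := by
          have : j % 2 ≠ 1 := by omega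
          simp [thueMorseLetter, this]
        simp [h0, h1, h2]
      · simp [h0, h1]
  have hraw : ∀ j : ℕ, (j : ℤ) ≤ 2 * 4 ^ K →
      ∃ e, rawCell G f P (c - 1 + j) = some (.raw e (thueMorseLetter j).bit) ∧
        (e = true → j = 0 ∨ (j : ℤ) = 2 * 4 ^ K) := by
    intro j hj
    obtain ⟨v, hv⟩ := Option.ne_none_iff_exists'.1 (mt (hne j).1 (by simpa using hj))
    rw [rawCell, hv]
    refine ⟨_, by rw [Option.map_some, hletter j v hv], fun he => ?_⟩
    have := hcard j v hv hj
    rw [of_decide_eq_true he] at this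
    by_contra! hc
    simp [hc.1, hc.2] at this
  have hodd : ∀ s : ℕ, (thueMorseLetter (2 * s + 1)).bit = some (thueMorse s) := fun s => by
    rw [thueMorseLetter_odd, Letter.bit_ofBool]
  have heven : ∀ s : ℕ, (thueMorseLetter (2 * s)).bit = none := fun s => by
    rw [thueMorseLetter_even]; rfl
  obtain ⟨j, hv, hj⟩ := hpos v
  have hc : rawCell G f P (c - 1 + j) = some (.raw (decide ((G.neighborSet v).ncard = 1))
      (thueMorseLetter j).bit) := by
    rw [rawCell, hv, Option.map_some, hletter j v hv]
  rw [(represents_rawCell hzero).run_succ hP hv hc]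
  rcases Nat.even_or_odd' j with ⟨s, rfl | rfl⟩
  · rw [heven]
    by_cases h0 : s = 0
    · subst h0
      have h1 : ¬ ((0 : ℤ) = 2 * 4 ^ K) := by omega
      have hl : rawCell G f P (c - 1 + (2 * 0 : ℕ) - 1) = none := by
        rw [show c - 1 + ((2 * 0 : ℕ) : ℤ) - 1 = c - 1 + -1 by simp; ring, rawCell,
          (hne (-1)).2 (by omega)]
        rfl
      obtain ⟨e, he, -⟩ := hraw (2 * 0 + 1) (by push_cast; omega)
      rw [hodd] at he
      rw [hl, hcard _ v hv hj, show c - 1 + ((2 * 0 : ℕ) : ℤ) + 1 = c - 1 + ((2 * 0 + 1 : ℕ) : ℤ) by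
        push_cast; ring, he]
      simp [h1, cellRule, Verdict.toState]
    · obtain ⟨p, rfl⟩ : ∃ p, s = p + 1 := ⟨s - 1, by omega⟩
      obtain ⟨e, he, -⟩ := hraw (2 * p + 1) (by push_cast at *; omega)
      rw [hodd] at he
      rw [show c - 1 + ((2 * (p + 1) : ℕ) : ℤ) - 1 = c - 1 + ((2 * p + 1 : ℕ) : ℤ) by
        push_cast; ring, he]
      by_cases h1 : ((2 * (p + 1) : ℕ) : ℤ) = 2 * 4 ^ K
      · have hr : rawCell G f P (c - 1 + (2 * (p + 1) : ℕ) + 1) = none := by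
          rw [add_assoc, rawCell, (hne _).2 (by omega)]
          rfl
        rw [hr, hcard _ v hv hj, if_pos h1]
        simp [cellRule, Verdict.toState]
      · obtain ⟨e', he', -⟩ := hraw (2 * (p + 1) + 1) (by push_cast at *; omega)
        rw [hodd] at he'
        rw [show c - 1 + ((2 * (p + 1) : ℕ) : ℤ) + 1 = c - 1 + ((2 * (p + 1) + 1 : ℕ) : ℤ) by
          push_cast; ring, he']
        simp [cellRule, Verdict.toState]
  · rw [hodd]
    obtain ⟨e, he, hend⟩ := hraw (2 * s) (by push_cast at *; omega)
    obtain ⟨e', he', -⟩ := hraw (2 * (s + 1)) (by push_cast at *; omega)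
    rw [heven] at he he'
    rw [show c - 1 + ((2 * s + 1 : ℕ) : ℤ) - 1 = c - 1 + ((2 * s : ℕ) : ℤ) by push_cast; ring, he,
      show c - 1 + ((2 * s + 1 : ℕ) : ℤ) + 1 = c - 1 + ((2 * (s + 1) : ℕ) : ℤ) by
        push_cast; ring, he']
    -- The bit next to the left end is the initial zero, so `spawn` does not reject even if it is
    -- the only bit.
    have hs : e = true → thueMorse s = false := by
      intro h
      rcases hend h with h' | h'
      · rw [show s = 0 by omega, thueMorse_zero]
      · push_cast at *; omega
    cases e
    · simp [cellRule, spawn, Verdict.toState]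
    · rw [hs rfl]
      cases e' <;> simp [cellRule, spawn, Verdict.toState]

/-! ### The final wave -/

/-- The cells of the nodes during the final wave. -/
def Cell.IsCalm (c : Cell) : Prop := c = .relay none none ∨ c = .finish ∨ c = .mark

/-- The states of the nodes during the final wave. -/
def NodeState.IsCalm (s : NodeState) : Prop := s = .yes ∨ ∃ l c, s = .run l c ∧ c.IsCalm

/-- Calm cells emit no signals, so relays stay silent, and none of the remaining rules rejects. -/
theorem isCalm_toState_cellRule {l r : Option Cell} {c : Cell} (hc : c.IsCalm)
    (hl : ∀ d, l = some d → d.IsCalm) (hr : ∀ d, r = some d → d.IsCalm) (lab : Label) :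
    ((cellRule l c r).toState lab).IsCalm := by
  rcases hc with rfl | rfl | rfl
  · have h1 : l.bind Cell.toRight = none := by
      rcases l with _ | d
      · rfl
      · rcases hl d rfl with rfl | rfl | rfl <;> rfl
    have h2 : r.bind Cell.toLeft = none := by
      rcases r with _ | d
      · rfl
      · rcases hr d rfl with rfl | rfl | rfl <;> rfl
    rw [cellRule_relay, relayRule, h1, h2]
    split_ifs
    · exact Or.inl rfl
    · exact Or.inr ⟨_, _, rfl, Or.inr (Or.inr rfl)⟩
    · exact Or.inr ⟨_, _, rfl, Or.inr (Or.inr rfl)⟩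
    · exact Or.inr ⟨_, _, rfl, Or.inl rfl⟩
  · rw [cellRule_finish]
    split_ifs
    · exact Or.inl rfl
    · exact Or.inr ⟨_, _, rfl, Or.inr (Or.inr rfl)⟩
    · exact Or.inr ⟨_, _, rfl, Or.inr (Or.inl rfl)⟩
  · rw [cellRule_mark]
    split_ifs
    · exact Or.inl rfl
    · exact Or.inr ⟨_, _, rfl, Or.inr (Or.inr rfl)⟩

theorem NodeState.IsCalm.ne_no {s : NodeState} (h : s.IsCalm) : s ≠ .no := by
  rcases h with rfl | ⟨l, c, rfl, -⟩ <;> simp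

theorem isCalm_of_le {s t : ℕ} (hst : s ≤ t) (h : ∀ v, (run G f s v).IsCalm) (v : V) :
    (run G f t v).IsCalm := by
  induction t, hst using Nat.le_induction generalizing v with
  | base => exact h v
  | succ t _ ih =>
    rcases ih v with hv | ⟨l, c, hv, hc⟩
    · exact Or.inl (run_eq_yes_of_le t.le_succ hv)
    · have hpick : ∀ l d, pick (received G f t v) l = some d → d.IsCalm := by
        intro l d hd
        obtain ⟨w, -, -, hw⟩ := exists_adj_of_pick_eq_some hd
        rcases ih w with hw' | ⟨l', c', hw', hc'⟩
        · rw [hw] at hw'; cases hw'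
        · rw [hw] at hw'; cases hw'; exact hc'
      rw [run_succ, hv, transition]
      split_ifs with h1 h2
      · obtain ⟨w, -, hw⟩ := h1
        exact absurd hw (ih w).ne_no
      · exact Or.inl rfl
      · exact isCalm_toState_cellRule hc (hpick _) (hpick _) l

/-- The final wave passes from a node to its right neighbour. -/
theorem run_succ_of_mark {t : ℕ} (hcalm : ∀ v, (run G f t v).IsCalm) {u v : V}
    (hor : IsOriented G f v) (huv : G.Adj v u) (hl : (f u).1 = (f v).1.prev)
    (hu : run G f t u = .yes ∨ run G f t u = .run (f u).1 .mark) :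
    run G f (t + 1) v = .yes ∨ run G f (t + 1) v = .run (f v).1 .mark ∧
      ∃ w, G.Adj v w ∧ (f w).1 = (f v).1.next := by
  have hcalm' := isCalm_of_le t.le_succ hcalm
  by_cases hyes : ∃ w, G.Adj v w ∧ run G f t w = .yes
  · obtain ⟨w, hw, hwy⟩ := hyes
    exact Or.inl (run_succ_of_yes hw hwy (hcalm' v).ne_no)
  · push Not at hyes
    rcases hcalm v with hv | ⟨l, c, hv, hc⟩
    · exact Or.inl (run_eq_yes_of_le t.le_succ hv)
    · obtain rfl := run_label hv
      have hu' := hu.resolve_left (hyes u huv)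
      have hpick := hor.pick_eq_some huv hu'
      rw [hl] at hpick
      rw [run_succ_of_run hv (fun w _ => (hcalm w).ne_no) hyes, hpick]
      have hnext : pick (received G f t v) (f v).1.next ≠ none →
          ∃ w, G.Adj v w ∧ (f w).1 = (f v).1.next := by
        intro hne
        obtain ⟨d, hd⟩ := Option.ne_none_iff_exists'.1 hne
        obtain ⟨w, hw, hwl, -⟩ := exists_adj_of_pick_eq_some hd
        exact ⟨w, hw, hwl⟩
      have hrule : ∀ r, cellRule (some .mark) c r = if r = none then .accept else .continue .mark := by
        intro r
        rcases hc with rfl | rfl | rfl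
        · rw [cellRule_relay, relayRule, if_pos rfl]
        · rw [cellRule_finish, if_pos rfl]
        · simp [cellRule_mark]
      rw [hrule]
      split_ifs with hn
      · exact Or.inl rfl
      · exact Or.inr ⟨rfl, hnext hn⟩

/-- The left end marks itself in round `t + 1`, the wave needs one round for each further node, and
the acceptance at the right end floods back unopposed because all cells are calm. -/
theorem AtLevel.eventually_yes [Finite V] (hG : G.Connected) (hP : IsTrack G f P) {k : ℕ} {b : ℤ}
    {a : ℤ → Option Bool} (h : IsLevel f P k b a) {t : ℕ} (ht : AtLevel G f P t (spacing k) b a)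
    {q : ℤ} (hq : a q = some false) (hsingle : ∀ p, a p ≠ none → p = q) (v : V) :
    run G f (t + 1 + 2 * 4 ^ k + Nat.card V) v = .yes := by
  have hd := one_lt_spacing k
  obtain ⟨g1, g2⟩ := h.block q (by rw [hq]; simp)
  have hdom : ∀ i, P i ≠ none ↔
      b + spacing k * q - 1 ≤ i ∧ i ≤ b + spacing k * q + spacing k - 1 := by
    refine fun i => ⟨fun hi => ?_, fun hi => hP.isInterval _ _ _ hi.1 hi.2 g1 g2⟩
    obtain ⟨p, hp, h1⟩ := h.cover i hi
    rwa [hsingle p hp] at h1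
  have hn1 : a (q - 1) = none := by
    by_contra hc
    have := hsingle _ hc
    omega
  have hn2 : a (q + 1) = none := by
    by_contra hc
    have := hsingle _ hc
    omega
  have hverdict : ∀ i, P i ≠ none → levelVerdict (spacing k) b a i =
      .continue (if i = b + spacing k * q then .finish else .relay none none) := by
    intro i hi
    by_cases hdvd : spacing k ∣ i - b
    · obtain ⟨p, hp⟩ := hdvd
      obtain rfl : i = b + spacing k * p := by omega
      obtain rfl := hsingle p ((h.symbol p).2 hi)
      rw [levelVerdict_mul (by omega) hq, hn1, hn2]
      simp [spawn]
    · rw [levelVerdict_of_not_dvd hdvd, if_neg]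
      rintro rfl
      exact hdvd (by simp)
  have hrep : Represents G f P t fun i => if P i = none then none else
      some (if i = b + spacing k * q then .finish else .relay none none) := by
    refine ⟨fun i hi => if_pos hi, fun i v hv => ?_⟩
    have hi : P i ≠ none := by rw [hv]; simp
    refine ⟨_, if_neg hi, ?_⟩
    rw [ht i v hv, hverdict i hi]
    rfl
  have hcalm : ∀ v, (run G f t v).IsCalm := by
    intro v
    obtain ⟨i, hv⟩ := hP.surj v
    rw [ht i v hv, hverdict i (by rw [hv]; simp)]
    refine Or.inr ⟨_, _, rfl, ?_⟩
    split_ifs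
    · exact Or.inr (Or.inl rfl)
    · exact Or.inl rfl
  have hwave : ∀ j : ℕ, (j : ℤ) ≤ spacing k → ∀ v, P (b + spacing k * q - 1 + j) = some v →
      run G f (t + 1 + j) v = .yes ∨ run G f (t + 1 + j) v = .run (f v).1 .mark := by
    intro j
    induction j with
    | zero =>
      intro _ v hv
      rw [Nat.cast_zero, add_zero] at hv
      have hi : P (b + spacing k * q - 1) ≠ none := by rw [hv]; simp
      have h0 : P (b + spacing k * q - 1 - 1) = none := by
        by_contra hc
        have := (hdom _).1 hc
        omega
      right
      rw [add_zero, hrep.run_succ hP hv (if_neg hi), if_pos h0, sub_add_cancel,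
        if_neg ((h.symbol q).1 (by rw [hq]; simp)), if_pos rfl,
        if_neg (show ¬ b + spacing k * q - 1 = b + spacing k * q by omega), cellRule_relay]
      simp [relayRule, Verdict.toState]
    | succ j ih =>
      intro hj v hv
      have e : b + spacing k * q - 1 + ((j + 1 : ℕ) : ℤ) - 1 = b + spacing k * q - 1 + j := by
        push_cast; ring
      obtain ⟨u, hu⟩ := Option.ne_none_iff_exists'.1
        ((hdom (b + spacing k * q - 1 + j)).2 ⟨by omega, by push_cast at hj; omega⟩)
      have hu' : P (b + spacing k * q - 1 + ((j + 1 : ℕ) : ℤ) - 1) = some u := by rw [e, hu]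
      rcases run_succ_of_mark (isCalm_of_le (by omega) hcalm) (hP.isOriented v)
        ((hP.adj_iff hv).2 (Or.inl hu')) (hP.label_prev hv hu')
        (ih (by push_cast at hj; omega) u hu) with h' | ⟨h', -⟩
      · exact Or.inl h'
      · exact Or.inr h'
  have hcast : ((2 * 4 ^ k : ℕ) : ℤ) = spacing k := by rw [spacing]; push_cast; rfl
  obtain ⟨n, hn⟩ : ∃ n : ℕ, 2 * 4 ^ k = n + 1 := ⟨2 * 4 ^ k - 1, by omega⟩
  rw [hn] at hcast ⊢
  push_cast at hcast
  obtain ⟨u, hu⟩ := Option.ne_none_iff_exists'.1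
    ((hdom (b + spacing k * q - 1 + n)).2 ⟨by omega, by omega⟩)
  obtain ⟨v', hv'⟩ := Option.ne_none_iff_exists'.1 g2
  have hu' : P (b + spacing k * q + spacing k - 1 - 1) = some u := by
    rw [← hu]; congr 1; omega
  have hyes : run G f (t + 1 + (n + 1)) v' = .yes := by
    rcases run_succ_of_mark (isCalm_of_le (by omega) hcalm) (hP.isOriented v')
      ((hP.adj_iff hv').2 (Or.inl hu')) (hP.label_prev hv' hu')
      (hwave n (by omega) u hu) with h' | ⟨-, w, hw, hl⟩
    · exact h'
    · rcases (hP.adj_iff hv').1 hw with h' | h'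
      · exact absurd ((hP.label_prev hv' h').symm.trans hl) (Label.prev_ne_next _)
      · have := ((hdom _).1 (show P _ ≠ none by rw [h']; simp)).2
        omega
  exact eventually_all_yes hG hyes (fun s hs v => (isCalm_of_le (by omega) hcalm v).ne_no) v

/-! ### Correctness and running time -/

theorem eventually_no_of_verdict [Finite V] (hG : G.Connected) (hP : IsTrack G f P) {t : ℕ}
    (ht : 1 ≤ t) {w : ℤ → Verdict} (hw : ∀ i v, P i = some v → run G f t v = (w i).toState (f v).1)
    (haccept : ∀ i, w i ≠ .accept) (hmark : ∀ i, w i ≠ .continue .mark) {i : ℤ} (hi : P i ≠ none)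
    (hreject : w i = .reject) (v : V) : run G f (t + Nat.card V) v = .no := by
  obtain ⟨u, hu⟩ := Option.ne_none_iff_exists'.1 hi
  have hno : run G f t u = .no := by rw [hw i u hu, hreject]; rfl
  refine eventually_all_no hG hno (never_yes hG ht hno (fun v hv => ?_) fun v hv => ?_) v
  · obtain ⟨j, hj⟩ := hP.surj v
    rw [hw j v hj] at hv
    exact haccept j (Verdict.toState_injective (f v).1 (hv.trans rfl))
  · obtain ⟨j, hj⟩ := hP.surj v
    rw [hw j v hj] at hv
    exact hmark j (Verdict.toState_injective (f v).1 (hv.trans rfl))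

theorem levelVerdict_ne_accept (d b : ℤ) (a : ℤ → Option Bool) (i : ℤ) :
    levelVerdict d b a i ≠ .accept := by
  rw [levelVerdict]
  split_ifs
  · exact spawn_ne_accept _ _ _
  · simp

theorem levelVerdict_ne_mark (d b : ℤ) (a : ℤ → Option Bool) (i : ℤ) :
    levelVerdict d b a i ≠ .continue .mark := by
  rw [levelVerdict]
  split_ifs
  · exact spawn_ne_mark _ _ _
  · simp

theorem decision_ne_accept (d b : ℤ) (a : ℤ → Option Bool) (i : ℤ) :
    decision d b a i ≠ .accept := by
  rw [decision]
  split_ifs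
  · exact decideBlock_ne_accept _ _
  · simp

theorem decision_ne_mark (d b : ℤ) (a : ℤ → Option Bool) (i : ℤ) :
    decision d b a i ≠ .continue .mark := by
  rw [decision]
  split_ifs
  · exact decideBlock_ne_mark _ _
  · simp

/-- Induction on a bound for the number of remaining levels. The equation for `t` is the closed form
of the starting time: round one for level zero, plus `14 * 4 ^ j` rounds for each level `j < k`.
Since `2 * 4 ^ k` is at most the number of nodes, one more phase or wave and a final flood fit into
`20 * Nat.card V`. -/
theorem IsLevel.decides [Finite V] (hG : G.Connected) (hP : IsTrack G f P) (m : ℕ) :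
    ∀ (k : ℕ) (b : ℤ) (a : ℤ → Option Bool) (t : ℕ), Nat.card V ≤ k + m → IsLevel f P k b a →
      AtLevel G f P t (spacing k) b a → (∃ q, a q ≠ none) → 3 * t + 11 = 14 * 4 ^ k →
      (IsThueMorseTrack f P ∧ ∀ v, run G f (20 * Nat.card V) v = .yes) ∨
        (¬ IsThueMorseTrack f P ∧ ∀ v, run G f (20 * Nat.card V) v = .no) := by
  induction m with
  | zero =>
    intro k b a t hk h ht ⟨q, hq⟩ _
    -- No level `k` with `Nat.card V ≤ k` is reached, as `2 * 4 ^ k` exceeds `k`.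
    have h1 := h.spacing_le_card hP ht hq
    have h2 := Nat.lt_pow_self (n := k) (a := 4) (by norm_num)
    omega
  | succ m ih =>
    intro k b a t hk h ht hne htime
    have hd := one_lt_spacing k
    have hcard : 2 * 4 ^ k ≤ Nat.card V := h.spacing_le_card hP ht hne.choose_spec
    have hpow : 1 ≤ 4 ^ k := Nat.one_le_pow _ _ (by norm_num)
    have hia := h.isInterval hP
    by_cases hns : ∀ q, a q ≠ none → a (q - 1) ≠ none ∨ a (q + 1) ≠ none
    · have hphase := fun i v hv => (h.represents hns ht).phase (i := i) (v := v) hd hP.isInterval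
        h.symbol hns hP hv
      have htn : (spacing k).toNat = 2 * 4 ^ k := by rw [spacing]; norm_cast
      by_cases hcov : ∀ q, a q ≠ none → IsCovered a q
      · obtain ⟨b', a', h', hdec⟩ := h.exists_succ hP hne hcov
        have hat : AtLevel G f P (t + 7 * (spacing k).toNat) (spacing (k + 1)) b' a' := by
          intro i v hv
          rw [hphase i v hv, hdec i (by rw [hv]; simp)]
        refine ih (k + 1) b' a' _ (by omega) h' hat ?_ ?_
        · obtain ⟨q, hq⟩ := hne
          obtain ⟨p, hp, -⟩ := h'.cover _ ((h.symbol q).1 hq)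
          exact ⟨p, hp⟩
        · rw [htn, pow_succ]; omega
      · right
        -- In a valid word the bits form a prefix of length `4 ^ M`. For `M = 0` there would be a
        -- lone active node, which is excluded here; otherwise every bit is covered.
        refine ⟨fun hT => hcov fun q hq => ?_, fun v => ?_⟩
        · obtain ⟨q₀, M, hpre⟩ := h.exists_isThueMorsePrefix hT
          rcases M with _ | M
          · have hall : ∀ i, a i ≠ none → i = q₀ := by
              intro i hi
              have := hpre.2 i hi
              simp at this
              omega
            rcases hns q hq with h1 | h1 <;>
            · have e1 := hall _ h1
              have e2 := hall _ hq
              omega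
          · rw [pow_succ, mul_comm] at hpre
            exact hpre.isCovered q hq
        · push Not at hcov
          obtain ⟨q, hq, hnc⟩ := hcov
          obtain ⟨x, hx⟩ := Option.ne_none_iff_exists'.1 hq
          have := eventually_no_of_verdict hG hP (by omega) hphase (decision_ne_accept _ _ _)
            (decision_ne_mark _ _ _) ((h.symbol q).1 hq) (by
              rw [decision_mul (by omega) hx, decideBlock, if_neg]
              rwa [isCovered_shift, add_zero]) v
          exact run_eq_no_of_le (by omega) this
    · push Not at hns
      obtain ⟨q, hq, hn1, hn2⟩ := hns
      have hsingle : ∀ p, a p ≠ none → p = q := by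
        intro p hp
        rcases lt_trichotomy p q with hpq | hpq | hpq
        · exact absurd hn1 (hia p (q - 1) q (by omega) (by omega) hp hq)
        · exact hpq
        · exact absurd hn2 (hia q (q + 1) p (by omega) (by omega) hq hp)
      rcases hx : a q with _ | _ | _
      · exact absurd hx hq
      · left
        refine ⟨h.isThueMorseTrack hP hx hsingle, fun v => ?_⟩
        exact run_eq_yes_of_le (by omega) (ht.eventually_yes hG hP h hx hsingle v)
      · right
        refine ⟨fun hT => ?_, fun v => ?_⟩
        · obtain ⟨q₀, M, hpre⟩ := h.exists_isThueMorsePrefix hT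
          have := hpre.1 0 (by positivity)
          rw [Nat.cast_zero, add_zero] at this
          have e := hsingle q₀ (by rw [this]; simp)
          rw [e, hx, thueMorse_zero] at this
          simp at this
        · have := eventually_no_of_verdict hG hP (by omega) ht (levelVerdict_ne_accept _ _ _)
            (levelVerdict_ne_mark _ _ _) ((h.symbol q).1 hq) (by
              rw [levelVerdict_mul (by omega) hx, hn1, hn2]
              rfl) v
          exact run_eq_no_of_le (by omega) this

theorem IsTrack.decides [Finite V] (hG : G.Connected) (hP : IsTrack G f P)
    (h : ∀ v, run G f 1 v ≠ .no) :
    (IsThueMorseTrack f P ∧ ∀ v, run G f (20 * Nat.card V) v = .yes) ∨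
      (¬ IsThueMorseTrack f P ∧ ∀ v, run G f (20 * Nat.card V) v = .no) := by
  have := hG.nonempty
  obtain ⟨b, a, hne, hl, ha⟩ := hP.exists_isLevel_zero h
  exact hl.decides hG hP (Nat.card V) 0 b a 1 (by omega) ha hne (by norm_num)

theorem run_eq_yes_of_isThueMorseYes [Finite V] (hG : G.Connected) (h : IsThueMorseYes G f) (v : V) :
    run G f (20 * Nat.card V) v = .yes := by
  obtain ⟨P, hP, hT⟩ := h.exists_isTrack
  rcases hP.decides hG (hP.run_one_ne_no hT) with h' | h'
  · exact h'.2 v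
  · exact absurd hT h'.1

/-- If round one is passed, the graph unrolls to a track, which decides. Otherwise `never_yes`
applies at round one, because a raw cell neither accepts nor becomes a mark. -/
theorem run_eq_no_of_not_isThueMorseYes [Finite V] (hG : G.Connected) (h : ¬ IsThueMorseYes G f)
    (v : V) : run G f (20 * Nat.card V) v = .no := by
  have hcard : 0 < Nat.card V := @Nat.card_pos _ ⟨v⟩ _
  by_cases h1 : ∀ v, run G f 1 v ≠ .no
  · have hP := isTrack_unroll hG (fun v => isOriented_of_run_one (h1 v)) v
    rcases hP.decides hG h1 with h' | h'
    · exact absurd (hP.isThueMorseYes h'.1) h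
    · exact h'.2 v
  · push Not at h1
    obtain ⟨u, hu⟩ := h1
    have hzero : ∀ v, (∃ e s, run G f 0 v = .run (f v).1 (.raw e s)) ∨ run G f 0 v = .no := by
      intro v
      rw [run_zero, initialState]
      split_ifs <;> simp
    have hrule : ∀ (l r : Option Cell) (e s), cellRule l (.raw e s) r ≠ .accept ∧
        cellRule l (.raw e s) r ≠ .continue .mark := by
      intro l r e s
      rw [cellRule.eq_def]
      split <;> simp_all [spawn_ne_accept, spawn_ne_mark]
    have hone : ∀ v, run G f 1 v ≠ .yes ∧ run G f 1 v ≠ .run (f v).1 .mark := by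
      intro v
      by_cases hv : run G f 1 v = .no
      · simp [hv]
      · have hyes : ∀ w, run G f 0 w ≠ .yes := by
          intro w
          rcases hzero w with ⟨e, s, h'⟩ | h' <;> simp [h']
        obtain ⟨-, c, hc, hstep⟩ := exists_cell_of_run_succ hv (hyes v) fun w _ => hyes w
        rcases hzero v with ⟨e, s, h'⟩ | h'
        · rw [hc] at h'
          cases h'
          rw [zero_add] at hstep
          obtain ⟨r1, r2⟩ := hrule (pick (received G f 0 v) (f v).1.prev)
            (pick (received G f 0 v) (f v).1.next) e s
          rw [hstep]
          exact ⟨fun h' => r1 (Verdict.toState_injective (f v).1 (h'.trans rfl)),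
            fun h' => r2 (Verdict.toState_injective (f v).1 (h'.trans rfl))⟩
        · rw [hc] at h'
          cases h'
    have := eventually_all_no hG hu (never_yes hG le_rfl hu (fun v => (hone v).1)
      fun v => (hone v).2) v
    exact run_eq_no_of_le (by omega) this

theorem thueMorseMachine_solvesInTime :
    thueMorseMachine.SolvesInTime ThueMorse allGraphs fun n => 20 * n := by
  classical
  intro V _ G hG _ f
  let o : Answer := if IsThueMorseYes G f then .yes else .no
  have hrun : ∀ v, run G f (20 * Nat.card V) v = thueMorseMachine.answer o := by
    intro v
    by_cases h : IsThueMorseYes G f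
    · rw [run_eq_yes_of_isThueMorseYes hG h, show o = .yes from if_pos h]; rfl
    · rw [run_eq_no_of_not_isThueMorseYes hG h, show o = .no from if_neg h]; rfl
  have hhalt : ∀ v, run G f (20 * Nat.card V) v ∈ thueMorseMachine.halting := by
    intro v
    rw [hrun]
    cases o
    · exact Or.inl rfl
    · exact Or.inr rfl
  have hex : ∃ t, ∀ v, run G f t v ∈ thueMorseMachine.halting := ⟨_, hhalt⟩
  have hle : Nat.find hex ≤ 20 * Nat.card V := Nat.find_min' hex hhalt
  refine ⟨Nat.find hex, ⟨Nat.find_spec hex, fun r hr => Nat.find_min' hex hr⟩, hle, fun _ => o,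
    ⟨fun h _ => if_pos h, fun h _ => if_neg h⟩, fun v => ?_⟩
  rw [← thueMorseMachine.exec_of_halting G f hle (Nat.find_spec hex v)]
  exact hrun v

end SetBroadcast

theorem theorem2 :
    (∃ (A : SetBroadcast.Machine (SetBroadcast.Label × SetBroadcast.Letter) SetBroadcast.Answer)
        (T U : ℕ → ℕ),
      A.SolvesInTime SetBroadcast.ThueMorse SetBroadcast.allGraphs T ∧
      A.UsesSpace SetBroadcast.allGraphs U ∧
      Asymptotics.IsTheta Filter.atTop (fun n : ℕ => (T n : ℝ)) (fun n : ℕ => (n : ℝ)) ∧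
      Asymptotics.IsBigO Filter.atTop (fun n : ℕ => (U n : ℝ)) (fun _ : ℕ => (1 : ℝ))) ∧
    (∃ c : ℝ, 0 < c ∧ ∃ n₀ : ℕ,
      ∀ (A : SetBroadcast.Machine (SetBroadcast.Label × SetBroadcast.Letter) SetBroadcast.Answer)
        (T : ℕ → ℕ),
        A.SolvesInTime SetBroadcast.ThueMorse (SetBroadcast.maxDegreeAtMost 2) T →
        ∀ n : ℕ, n₀ ≤ n → c * (n : ℝ) ≤ (T n : ℝ)) := by
  constructor
  · obtain ⟨u, hu⟩ := SetBroadcast.exists_usesSpace_thueMorseMachine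
    refine ⟨_, fun n => 20 * n, fun _ => u, SetBroadcast.thueMorseMachine_solvesInTime, hu, ?_, ?_⟩
    · push_cast
      exact (Asymptotics.isTheta_refl _ _).const_mul_left (by norm_num)
    · exact Asymptotics.isBigO_const_const _ one_ne_zero _
  -- The bound `n - 2` is at least `n / 2` from `n = 4` on.
  · refine ⟨1 / 2, by norm_num, 4, fun A T hA n hn => ?_⟩
    obtain ⟨m, rfl⟩ := Nat.exists_eq_add_of_le' (show 2 ≤ n by omega)
    have h1 : (m : ℝ) ≤ T (m + 2) := by exact_mod_cast SetBroadcast.linear_lower_bound A T hA m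
    have h2 : (2 : ℝ) ≤ m := by exact_mod_cast (show 2 ≤ m by omega)
    push_cast
    linarith
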